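/- **Conventions.** *Machine.* Running times are counted on a random access machine with word cells and real cells, all initially zero apart from the input. On inputs of size $n$ the words are smaller than $(n+2)^{\kappa}$ for a constant $\kappa$ of the algorithm, i.e. they have $O(\log n)$ bits; words can be added, subtracted, multiplied, divided with rounding, compared, and used as addresses. The real cells hold exact real numbers; the operations on them are $+,-,\times,/,\exp,\ln$ and comparison, and a word can be read as a real number (but there is no rounding of reals to words). Every operation has unit cost. An algorithm is one fixed program. *3-OV.* Given three sets $A_1,A_2,A_3\subset\{0,1\}^d$ of size $n$, decide whether there are $v_k\in A_k$ such that for every $j\in[d]$ at least one of $v_1[j],v_2[j],v_3[j]$ is $0$. *3-OV Hypothesis:* for every $\varepsilon>0$ there is a $c$ such that no algorithm decides 3-OV on sets of $n$ vectors of dimension $d=c\lceil\log_2 n\rceil$ in time $O(n^{3-\varepsilon})$. *Almost-everywhere form:* for every $\varepsilon>0$ there is a $c$ such that the worst-case time of every algorithm deciding 3-OV on sets of $n$ vectors of dimension $c\lceil\log_2 n\rceil$ is at least $n^{3-\varepsilon}$ for all sufficiently large $n$. *Transformers.* A transformer with $L\ge1$ layers, $H\ge1$ heads per layer, embedding dimension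 $m\ge1$ and output dimension $d_{\rm out}\ge1$ is given by maps $Q_{\ell,h},K_{\ell,h},V_{\ell,h}:\mathbb R^m\to\mathbb R^m$ and continuous maps (MLPs) $\Psi_\ell:\mathbb R^m\to\mathbb R^m$, $\Psi_O:\mathbb R^m\to\mathbb R^{d_{\rm out}}$. All maps are applied row-wise to matrices. On input $X=X^{(0)}\in\mathbb R^{N\times m}$ it computes $$X^{(\ell)}=\Psi_\ell\Big(X^{(\ell-1)}+\sum_{h=1}^{H}\mathrm{softmax}\big(Q_{\ell,h}(X^{(\ell-1)})K_{\ell,h}(X^{(\ell-1)})^{\top}\big)V_{\ell,h}(X^{(\ell-1)})\Big),\qquad 1\le\ell\le L,$$ with softmax applied to each row, and outputs $T(X)=\Psi_O(X^{(L)})$. *Families.* A family of transformers for 3-OV in dimension $d=c\lceil\log_2 n\rceil$ consists, for each $n$, of a transformer $T_n$ with parameters $L,H,m,d_{\rm out}$, a context length $N$ with $n\le N=O(n)$, and an input encoding in which the $t$-th token ($0\le t<N$) is a vector in $\mathbb R^m$ depending on the position $t$ and on the vectors number $t\bmod n$ of the three (listed) sets. (All these parameters may depend on $n$.) It *computes 3-OV*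 if, for every $n\ge1$ and every instance, the first coordinate of the output at the first token is positive exactly when an orthogonal triple exists. It has *linear-time embedding and MLP maps* if there are an algorithm that, given $n$ and $d$, writes $N,L,H,m,d_{\rm out}$ and any weights in time $\tilde O(N^2mHL)$, and algorithms that, using these stored data, compute the token encodings, the maps $Q_{\ell,h},K_{\ell,h},V_{\ell,h}$ (given $\ell,h$ and a vector), $\Psi_\ell$ (given $\ell$ and a vector) and $\Psi_O$ in time $\tilde O(m)$ per vector. Here $\tilde O$ hides factors $(1+\log n)^{O(1)}$. **Theorem.** 1. Every family of transformers with linear-time embedding and MLP maps can be evaluated in time $\tilde O(N^2mHL)$: there is an algorithm that, given $n$, $d$ and any $X\in\mathbb R^{N\times m}$, outputs $T_n(X)\in\mathbb R^{N\times d_{\rm out}}$ within this time, for all $n\ge1$. 2. Under the 3-OV Hypothesis, any transformer with linear-time embedding and MLP maps that computes 3-OV requires $LHm\ge N^{1-o(1)}$. That is: for every $\varepsilon>0$ there is a $c$ such that no family of transformers with linear-time embedding and MLP maps that computes 3-OV in dimension $c\lceil\log_2 n\rceil$ has $LHm=O(N^{1-\varepsilon})$. 3. Under the almost-everywhere form of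 the 3-OV Hypothesis, for every $\varepsilon>0$ there is a $c$ such that every family of transformers with linear-time embedding and MLP maps that computes 3-OV in dimension $c\lceil\log_2 n\rceil$ satisfies $LHm\ge N^{1-\varepsilon}$ for all sufficiently large $n$. -/

import Mathlib

open Filter Asymptotics
open scoped Matrix

noncomputable section

/-! ### The machine: a random access machine with words and real cells

The machine has word arrays and real arrays, each array having a fixed name (a number written in the
program) and being indexed by words.  Its operations on real numbers are those of extended arithmetic
circuits (`+`, `-`, `*`, `/`, `exp`, `ln`) and comparison; there is no rounding and no conversion of a
real number to a word, and no real constants other than those computed from words. -/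

namespace RealRAM

/-- Memory contents: `w a i` is cell `i` of word array `a`, `r a i` is cell `i` of real array `a`. -/
@[ext] structure State where
  w : ℕ → ℕ → ℕ
  r : ℕ → ℕ → ℝ

/-- Word expressions; `get a e` is cell `e` of word array `a`, `sub` is truncated at `0`, `div` rounds
down. -/
inductive WExp where
  | const (c : ℕ)
  | get (a : ℕ) (e : WExp)
  | add (e f : WExp)
  | sub (e f : WExp)
  | mul (e f : WExp)
  | div (e f : WExp)

def WExp.eval (σ : State) : WExp → ℕ
  | .const c => c
  | .get a e => σ.w a (e.eval σ)
  | .add e f => e.eval σ + f.eval σ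
  | .sub e f => e.eval σ - f.eval σ
  | .mul e f => e.eval σ * f.eval σ
  | .div e f => e.eval σ / f.eval σ

/-- Real expressions; `get a e` is cell `e` of real array `a`, `cast e` is a word read as a real. -/
inductive RExp where
  | get (a : ℕ) (e : WExp)
  | cast (e : WExp)
  | add (e f : RExp)
  | sub (e f : RExp)
  | mul (e f : RExp)
  | div (e f : RExp)
  | exp (e : RExp)
  | ln (e : RExp)

def RExp.eval (σ : State) : RExp → ℝ
  | .get a e => σ.r a (e.eval σ)
  | .cast e => (e.eval σ : ℝ)
  | .add e f => e.eval σ + f.eval σ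
  | .sub e f => e.eval σ - f.eval σ
  | .mul e f => e.eval σ * f.eval σ
  | .div e f => e.eval σ / f.eval σ
  | .exp e => Real.exp (e.eval σ)
  | .ln e => Real.log (e.eval σ)

inductive Test where
  | wlt (e f : WExp)
  | rlt (e f : RExp)

def Test.Holds (σ : State) : Test → Prop
  | .wlt e f => e.eval σ < f.eval σ
  | .rlt e f => e.eval σ < f.eval σ

inductive Prog where
  | skip
  | wset (a : ℕ) (i e : WExp)
  | rset (a : ℕ) (i : WExp) (e : RExp)
  | seq (p q : Prog)
  | ite (b : Test) (p q : Prog)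
  | loop (b : Test) (p : Prog)

def State.setW (σ : State) (a i v : ℕ) : State :=
  ⟨Function.update σ.w a (Function.update (σ.w a) i v), σ.r⟩

def State.setR (σ : State) (a i : ℕ) (v : ℝ) : State :=
  ⟨σ.w, Function.update σ.r a (Function.update (σ.r a) i v)⟩

/-- `Exec B p σ σ' t`: started in `σ`, the program `p` halts in `σ'` after `t` steps, and every word it
writes is smaller than `B`.  An assignment and a test cost one step each (an expression of a program has
constant size). A program that would write a word `≥ B` has no execution. -/
inductive Exec (B : ℕ) : Prog → State → State → ℕ → Prop
  | skip (σ : State) : Exec B .skip σ σ 1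
  | wset (σ : State) (a : ℕ) (i e : WExp) (h : e.eval σ < B) :
      Exec B (.wset a i e) σ (σ.setW a (i.eval σ) (e.eval σ)) 1
  | rset (σ : State) (a : ℕ) (i : WExp) (e : RExp) :
      Exec B (.rset a i e) σ (σ.setR a (i.eval σ) (e.eval σ)) 1
  | seq {p q : Prog} {σ σ' σ'' : State} {s t : ℕ} (h₁ : Exec B p σ σ' s) (h₂ : Exec B q σ' σ'' t) :
      Exec B (.seq p q) σ σ'' (s + t)
  | ite_true {b : Test} {p q : Prog} {σ σ' : State} {t : ℕ} (hb : b.Holds σ) (h : Exec B p σ σ' t) :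
      Exec B (.ite b p q) σ σ' (t + 1)
  | ite_false {b : Test} {p q : Prog} {σ σ' : State} {t : ℕ} (hb : ¬ b.Holds σ)
      (h : Exec B q σ σ' t) : Exec B (.ite b p q) σ σ' (t + 1)
  | loop_done {b : Test} {p : Prog} {σ : State} (hb : ¬ b.Holds σ) : Exec B (.loop b p) σ σ 1
  | loop_step {b : Test} {p : Prog} {σ σ' σ'' : State} {s t : ℕ} (hb : b.Holds σ)
      (h₁ : Exec B p σ σ' s) (h₂ : Exec B (.loop b p) σ' σ'' t) :
      Exec B (.loop b p) σ σ'' (s + t + 1)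

/-- Words have `O(log n)` bits on inputs of size `n`: they are smaller than `(n + 2) ^ κ`. -/
def wordBound (κ n : ℕ) : ℕ := (n + 2) ^ κ

/-- The memory that is zero except for `n` and `d` in cells `0` and `1` of word array `0`. -/
def initState (n d : ℕ) : State where
  w a i := if a = 0 then (if i = 0 then n else if i = 1 then d else 0) else 0
  r _ _ := 0

end RealRAM

/-! ### Three orthogonal vectors -/

/-- Three lists of `n` vectors in `{0,1}^d`. -/
abbrev OVInstance (n d : ℕ) : Type := Fin 3 → Fin n → Fin d → Bool

/-- There is an orthogonal triple: one vector of each list such that, in every coordinate, at least one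
of the three is `0`. -/
def HasOrthogonalTriple {n d : ℕ} (A : OVInstance n d) : Prop :=
  ∃ i : Fin 3 → Fin n, ∀ j : Fin d, ∃ k : Fin 3, A k (i k) j = false

/-- The dimension `c ⌈log₂ n⌉`. -/
def ovDim (c n : ℕ) : ℕ := c * Nat.clog 2 n

/-- The input memory for an instance: `n` and `d` in word array `0`, and bit `j` of vector `i` of list
`k` in cell `i * d + j` of word array `k + 1`; all other cells are zero. -/
def ovInput {n d : ℕ} (A : OVInstance n d) : RealRAM.State where
  w a x :=
    if a = 0 then (RealRAM.initState n d).w 0 x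
    else if h : a - 1 < 3 ∧ x < n * d then
      (if A ⟨a - 1, h.1⟩ (Fin.divNat ⟨x, h.2⟩) (Fin.modNat ⟨x, h.2⟩) = true then 1 else 0)
    else 0
  r _ _ := 0

/-- The program `p`, with words smaller than `(n + 2) ^ κ`, decides 3-OV on sets (lists without
repetition) of `n` vectors of dimension `c ⌈log₂ n⌉` in at most `time n` steps, for every `n ≥ 1`; the
answer is left in cell `0` of word array `0`. -/
def SolvesThreeOV (c : ℕ) (p : RealRAM.Prog) (κ : ℕ) (time : ℕ → ℕ) : Prop :=
  ∀ n : ℕ, 0 < n → ∀ A : OVInstance n (ovDim c n), (∀ k, Function.Injective (A k)) →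
    ∃ (σ : RealRAM.State) (t : ℕ),
      RealRAM.Exec (RealRAM.wordBound κ n) p (ovInput A) σ t ∧ t ≤ time n ∧
      (HasOrthogonalTriple A → σ.w 0 0 = 1) ∧ (¬ HasOrthogonalTriple A → σ.w 0 0 = 0)

/-- The 3-OV Hypothesis: for every `ε > 0` there is a `c` such that no algorithm decides 3-OV on sets of
`n` vectors of dimension `c ⌈log₂ n⌉` in time `O(n ^ (3 - ε))`. -/
def ThreeOVHypothesis : Prop :=
  ∀ ε : ℝ, 0 < ε → ∃ c : ℕ, ∀ (p : RealRAM.Prog) (κ : ℕ) (time : ℕ → ℕ), SolvesThreeOV c p κ time →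
    ¬ (fun n : ℕ => (time n : ℝ)) =O[atTop] (fun n : ℕ => (n : ℝ) ^ (3 - ε))

/-- The almost-everywhere form: for every `ε > 0` there is a `c` such that every algorithm that decides
3-OV on sets of `n` vectors of dimension `c ⌈log₂ n⌉` takes time at least `n ^ (3 - ε)` for all large
`n`. -/
def ThreeOVHypothesisAE : Prop :=
  ∀ ε : ℝ, 0 < ε → ∃ c : ℕ, ∀ (p : RealRAM.Prog) (κ : ℕ) (time : ℕ → ℕ), SolvesThreeOV c p κ time →
    ∀ᶠ n : ℕ in atTop, (n : ℝ) ^ (3 - ε) ≤ (time n : ℝ)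

/-! ### Transformers -/

def softmax {ι : Type*} [Fintype ι] (v : ι → ℝ) : ι → ℝ :=
  fun i => Real.exp (v i) / ∑ j, Real.exp (v j)

/-- A map on vectors applied to each row of a matrix. -/
def rowwise {N p q : ℕ} (f : (Fin p → ℝ) → (Fin q → ℝ)) (X : Matrix (Fin N) (Fin p) ℝ) :
    Matrix (Fin N) (Fin q) ℝ :=
  Matrix.of fun i => f (X i)

/-- The self-attention head `softmax(Q(X) K(X)ᵀ) V(X)`, with row-wise embedding maps. -/
def attentionHead {N p m : ℕ} (q k v : (Fin p → ℝ) → (Fin m → ℝ)) (X : Matrix (Fin N) (Fin p) ℝ) :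
    Matrix (Fin N) (Fin m) ℝ :=
  rowwise softmax (rowwise q X * (rowwise k X)ᵀ) * rowwise v X

/-- A transformer with `L` layers, `H` heads per layer, embedding dimension (and input dimension) `m`
and output dimension `dout`. -/
structure Transformer (L H m dout : ℕ) where
  query : Fin L → Fin H → (Fin m → ℝ) → (Fin m → ℝ)
  key : Fin L → Fin H → (Fin m → ℝ) → (Fin m → ℝ)
  value : Fin L → Fin H → (Fin m → ℝ) → (Fin m → ℝ)
  mlp : Fin L → (Fin m → ℝ) → (Fin m → ℝ)
  out : (Fin m → ℝ) → (Fin dout → ℝ)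
  continuous_mlp : ∀ l, Continuous (mlp l)
  continuous_out : Continuous out

namespace Transformer

variable {L H m dout : ℕ}

def layer (T : Transformer L H m dout) {N : ℕ} (l : Fin L) (X : Matrix (Fin N) (Fin m) ℝ) :
    Matrix (Fin N) (Fin m) ℝ :=
  rowwise (T.mlp l) (X + ∑ h, attentionHead (T.query l h) (T.key l h) (T.value l h) X)

/-- The embeddings `X^{(l)}` after `l` layers. -/
def hidden (T : Transformer L H m dout) {N : ℕ} (X : Matrix (Fin N) (Fin m) ℝ) :
    (l : ℕ) → l ≤ L → Matrix (Fin N) (Fin m) ℝ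
  | 0, _ => X
  | l + 1, h => T.layer ⟨l, h⟩ (T.hidden X l (Nat.le_of_succ_le h))

def eval (T : Transformer L H m dout) {N : ℕ} (X : Matrix (Fin N) (Fin m) ℝ) :
    Matrix (Fin N) (Fin dout) ℝ :=
  rowwise T.out (T.hidden X L le_rfl)

end Transformer

/-! ### Families of transformers for 3-OV -/

/-- For each `n`, a transformer for 3-OV instances with `n` vectors in each of the three sets, of
dimension `d = c ⌈log₂ n⌉`.  It reads a sequence of `N n = Θ(n)` tokens; the `t`-th token is an encoding
`emb n t` of its position `t` and of the vectors number `t mod n` of the three sets.  (So a token may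
hold one vector of each set, or a vector of one of the sets, or no vector at all.) -/
structure TransformerFamily (c : ℕ) where
  N : ℕ → ℕ
  L : ℕ → ℕ
  H : ℕ → ℕ
  m : ℕ → ℕ
  dout : ℕ → ℕ
  le_N : ∀ n, n ≤ N n
  N_le : ∃ C : ℕ, ∀ n, 0 < n → N n ≤ C * n
  L_pos : ∀ n, 0 < L n
  H_pos : ∀ n, 0 < H n
  m_pos : ∀ n, 0 < m n
  dout_pos : ∀ n, 0 < dout n
  T : ∀ n, Transformer (L n) (H n) (m n) (dout n)
  emb : ∀ n, ℕ → (Fin 3 → Fin (ovDim c n) → Bool) → (Fin (m n) → ℝ)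

namespace TransformerFamily

variable {c : ℕ}

/-- The token matrix of an instance. -/
def input (F : TransformerFamily c) {n : ℕ} (hn : 0 < n) (A : OVInstance n (ovDim c n)) :
    Matrix (Fin (F.N n)) (Fin (F.m n)) ℝ :=
  Matrix.of fun t => F.emb n t fun k => A k ⟨t % n, Nat.mod_lt _ hn⟩

/-- The transformers decide 3-OV: the first output coordinate of the first token is positive exactly on
the yes-instances. -/
def ComputesThreeOV (F : TransformerFamily c) : Prop :=
  ∀ (n : ℕ) (hn : 0 < n) (A : OVInstance n (ovDim c n)), (∀ k, Function.Injective (A k)) →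
    (0 < (F.T n).eval (F.input hn A) ⟨0, hn.trans_le (F.le_N n)⟩ ⟨0, F.dout_pos n⟩ ↔
      HasOrthogonalTriple A)

/-- The size `L H m` of the transformers. -/
def size (F : TransformerFamily c) (n : ℕ) : ℕ := F.L n * F.H n * F.m n

/-- The subroutine `p` maps the vector `x` to the vector `y` in at most `time` steps.  Word array `0` and
real array `0` hold the parameters and weights, as they are in `σ₀`, and must be left unchanged; the
integers `i`, `j` are passed in cells `0`, `1` of word array `1`, the vector `x` in real array `1`; the
vector `y` is returned in real array `2`.  Everything else in memory may initially be arbitrary. -/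
def Evaluates (B : ℕ) (p : RealRAM.Prog) (σ₀ : RealRAM.State) (i j : ℕ) {a b : ℕ} (x : Fin a → ℝ)
    (y : Fin b → ℝ) (time : ℕ) : Prop :=
  ∀ σ : RealRAM.State, σ.w 0 = σ₀.w 0 → σ.r 0 = σ₀.r 0 → σ.w 1 0 = i → σ.w 1 1 = j →
    (∀ u : Fin a, σ.r 1 u = x u) →
    ∃ (σ' : RealRAM.State) (t : ℕ), RealRAM.Exec B p σ σ' t ∧ t ≤ time ∧
      σ'.w 0 = σ₀.w 0 ∧ σ'.r 0 = σ₀.r 0 ∧ ∀ u : Fin b, σ'.r 2 u = y u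

/-- The bits of the three vectors of a token, one after the other, as real numbers `0` and `1`. -/
def tokenBits {d : ℕ} (v : Fin 3 → Fin d → Bool) : Fin (3 * d) → ℝ :=
  fun u => if v u.divNat u.modNat = true then 1 else 0

/-- The evaluation time `N² m H L` of the standard algorithm, up to logarithmic factors. -/
def evalTime (F : TransformerFamily c) (C n : ℕ) : ℕ :=
  C * (F.N n ^ 2 * F.m n * F.H n * F.L n) * (Nat.log 2 n + 1) ^ C

/-- The transformers have embedding and MLP maps computable in time linear in `m`, up to logarithmic
factors, by algorithms that are uniform in `n`: there are a set-up program that, given `n` and `d`,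
writes the sizes `N, L, H, m, dout` and any further parameters and weights, in time at most that of the
standard evaluation algorithm, and six programs that compute, with access to these parameters and
weights, the token encoding, the query, key and value maps of the head `h` in layer `l`, the MLP of layer
`l`, and the output MLP, each in `C m (log n) ^ C` steps. -/
def LinearTimeMaps (F : TransformerFamily c) : Prop :=
  ∃ (setup pemb pquery pkey pvalue pmlp pout : RealRAM.Prog) (κ C : ℕ), ∀ n : ℕ, 0 < n →
    ∃ (σ₀ : RealRAM.State) (t₀ : ℕ),
      RealRAM.Exec (RealRAM.wordBound κ n) setup (RealRAM.initState n (ovDim c n)) σ₀ t₀ ∧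
      t₀ ≤ F.evalTime C n ∧
      σ₀.w 0 0 = n ∧ σ₀.w 0 1 = ovDim c n ∧ σ₀.w 0 2 = F.N n ∧ σ₀.w 0 3 = F.L n ∧
      σ₀.w 0 4 = F.H n ∧ σ₀.w 0 5 = F.m n ∧ σ₀.w 0 6 = F.dout n ∧
      (∀ (t : Fin (F.N n)) (v : Fin 3 → Fin (ovDim c n) → Bool),
        Evaluates (RealRAM.wordBound κ n) pemb σ₀ t 0 (tokenBits v) (F.emb n t v)
          (C * F.m n * (Nat.log 2 n + 1) ^ C)) ∧
      (∀ (l : Fin (F.L n)) (h : Fin (F.H n)) (x : Fin (F.m n) → ℝ),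
        Evaluates (RealRAM.wordBound κ n) pquery σ₀ l h x ((F.T n).query l h x)
          (C * F.m n * (Nat.log 2 n + 1) ^ C) ∧
        Evaluates (RealRAM.wordBound κ n) pkey σ₀ l h x ((F.T n).key l h x)
          (C * F.m n * (Nat.log 2 n + 1) ^ C) ∧
        Evaluates (RealRAM.wordBound κ n) pvalue σ₀ l h x ((F.T n).value l h x)
          (C * F.m n * (Nat.log 2 n + 1) ^ C)) ∧
      (∀ (l : Fin (F.L n)) (x : Fin (F.m n) → ℝ),
        Evaluates (RealRAM.wordBound κ n) pmlp σ₀ l 0 x ((F.T n).mlp l x)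
          (C * F.m n * (Nat.log 2 n + 1) ^ C)) ∧
      (∀ x : Fin (F.m n) → ℝ,
        Evaluates (RealRAM.wordBound κ n) pout σ₀ 0 0 x ((F.T n).out x)
          (C * F.m n * (Nat.log 2 n + 1) ^ C))

/-- The memory that holds `n` and `d` in word array `0` and the matrix `X`, row by row, in real array
`1`, and is zero elsewhere. -/
def evalInput (d n : ℕ) {N m : ℕ} (X : Matrix (Fin N) (Fin m) ℝ) : RealRAM.State where
  w := (RealRAM.initState n d).w
  r a x := if h : a = 1 ∧ x < N * m then X (Fin.divNat ⟨x, h.2⟩) (Fin.modNat ⟨x, h.2⟩) else 0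

/-- One program evaluates all transformers of the family, on arbitrary real inputs, in time
`Õ(N² m H L)`; the output matrix is left, row by row, in real array `2`. -/
def EvaluableInStandardTime (F : TransformerFamily c) : Prop :=
  ∃ (p : RealRAM.Prog) (κ C : ℕ), ∀ n : ℕ, 0 < n → ∀ X : Matrix (Fin (F.N n)) (Fin (F.m n)) ℝ,
    ∃ (σ : RealRAM.State) (t : ℕ),
      RealRAM.Exec (RealRAM.wordBound κ n) p (evalInput (ovDim c n) n X) σ t ∧ t ≤ F.evalTime C n ∧
      ∀ (i : Fin (F.N n)) (j : Fin (F.dout n)), σ.r 2 (i * F.dout n + j) = (F.T n).eval X i j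

end TransformerFamily

end

namespace RealRAM

/-! ### Elementary facts about states and executions -/

namespace State

/-! The upper bound is the textbook evaluation, layer by layer and head by head. For one head, the
query, key and value maps are applied to the `N` rows by calling the given subroutines, which costs
`N` times `Õ(m)`. The `N²` exponentials of inner products of length `m`, their row sums and the
weighted sums of values then cost `O(N² m)`. Over all heads and layers this is `Õ(N² m H L)`, and
the set-up program fits into the same budget by assumption.

The work lies in making this precise for one fixed program. The given subroutines are black boxes
that may overwrite memory, so their arrays are renamed by `a ↦ 4a` (`Exec.rename`, `run_embedded`),
and the caller keeps its data in arrays whose names are not multiples of `4`; only array `0` is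
shared. All the caller's numerical work and copying is an instance of one double loop,
`Run.tabulate`. The layers of the program are `run_applyRows`, `run_attend`, `run_head`, `run_layer`
and `run_eval`. Addresses must be words: the set-up writes the sizes into words, so the sizes are
polynomial in `n`, and a larger word exponent accommodates their products (`exists_ready`).

For the lower bounds, computing the token encodings first and testing the sign of one output
afterwards turns a family that computes 3-OV into a 3-OV algorithm of time `Õ(N² · LHm)`
(`exists_solvesThreeOV`). Since `N = Θ(n)`, a size of at most `K N^(1-ε)` gives time `Õ(n^(3-ε))`,
where the implied constant depends linearly on `K` (`exists_evalTime_le`). The logarithms cost less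
than `n^(ε/2)`, so the hypothesis for `ε/2` is violated: as an `O`-bound for the second claim, and
separately at each large `n` for the third. -/

@[simp] theorem setW_w_self (σ : State) (a i v : ℕ) : (σ.setW a i v).w a i = v := by
  simp [setW]

theorem setW_w_cell_ne (σ : State) (a v : ℕ) {i j : ℕ} (h : j ≠ i) :
    (σ.setW a i v).w a j = σ.w a j := by
  simp [setW, h]

theorem setW_w_ne (σ : State) (i v : ℕ) {a b : ℕ} (h : b ≠ a) : (σ.setW a i v).w b = σ.w b := by
  simp [setW, h]

@[simp] theorem setW_r (σ : State) (a i v : ℕ) : (σ.setW a i v).r = σ.r := rfl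

@[simp] theorem setR_w (σ : State) (a i : ℕ) (v : ℝ) : (σ.setR a i v).w = σ.w := rfl

@[simp] theorem setR_r_self (σ : State) (a i : ℕ) (v : ℝ) : (σ.setR a i v).r a i = v := by
  simp [setR]

theorem setR_r_cell_ne (σ : State) (a : ℕ) (v : ℝ) {i j : ℕ} (h : j ≠ i) :
    (σ.setR a i v).r a j = σ.r a j := by
  simp [setR, h]

theorem setR_r_ne (σ : State) (i : ℕ) (v : ℝ) {a b : ℕ} (h : b ≠ a) :
    (σ.setR a i v).r b = σ.r b := by
  simp [setR, h]

end State

theorem Exec.mono {B B' : ℕ} (hB : B ≤ B') {p : Prog} {σ σ' : State} {t : ℕ}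
    (h : Exec B p σ σ' t) : Exec B' p σ σ' t := by
  induction h with
  | skip σ => exact .skip σ
  | wset σ a i e h => exact .wset σ a i e (h.trans_le hB)
  | rset σ a i e => exact .rset σ a i e
  | seq _ _ h₁ h₂ => exact .seq h₁ h₂
  | ite_true hb _ h => exact .ite_true hb h
  | ite_false hb _ h => exact .ite_false hb h
  | loop_done hb => exact .loop_done hb
  | loop_step hb _ _ h₁ h₂ => exact .loop_step hb h₁ h₂

/-- Words that are smaller than the word bound stay so. -/
theorem Exec.words_lt {B : ℕ} {p : Prog} {σ σ' : State} {t : ℕ} (h : Exec B p σ σ' t)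
    (hσ : ∀ a i, σ.w a i < B) : ∀ a i, σ'.w a i < B := by
  induction h with
  | skip σ => exact hσ
  | wset σ a i e h =>
    intro b j
    by_cases hb : b = a
    · subst hb
      by_cases hj : j = i.eval σ
      · subst hj; simpa using h
      · rw [State.setW_w_cell_ne _ _ _ hj]; exact hσ _ _
    · rw [State.setW_w_ne _ _ _ hb]; exact hσ _ _
  | rset σ a i e => exact hσ
  | seq _ _ h₁ h₂ => exact h₂ (h₁ hσ)
  | ite_true hb _ h => exact h hσ
  | ite_false hb _ h => exact h hσ
  | loop_done hb => exact hσ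
  | loop_step hb _ _ h₁ h₂ => exact h₂ (h₁ hσ)

/-- In `t` steps at most `t` real cells change. -/
theorem Exec.exists_changed {B : ℕ} {p : Prog} {σ σ' : State} {t : ℕ} (h : Exec B p σ σ' t) :
    ∃ S : Finset (ℕ × ℕ), S.card ≤ t ∧ ∀ a i, (a, i) ∉ S → σ'.r a i = σ.r a i := by
  induction h with
  | skip σ => exact ⟨∅, by simp, fun _ _ _ => rfl⟩
  | wset σ a i e h => exact ⟨∅, by simp, fun _ _ _ => rfl⟩
  | rset σ a i e =>
    refine ⟨{(a, i.eval σ)}, by simp, fun b j hj => ?_⟩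
    by_cases hb : b = a
    · subst hb
      exact State.setR_r_cell_ne _ _ _ (by rintro rfl; simp at hj)
    · rw [State.setR_r_ne _ _ _ hb]
  | seq _ _ h₁ h₂ =>
    obtain ⟨S, hS, h₁⟩ := h₁
    obtain ⟨S', hS', h₂⟩ := h₂
    refine ⟨S ∪ S', (Finset.card_union_le _ _).trans (by omega), fun a i hi => ?_⟩
    simp only [Finset.mem_union, not_or] at hi
    rw [h₂ a i hi.2, h₁ a i hi.1]
  | ite_true hb _ h =>
    obtain ⟨S, hS, h⟩ := h
    exact ⟨S, by omega, h⟩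
  | ite_false hb _ h =>
    obtain ⟨S, hS, h⟩ := h
    exact ⟨S, by omega, h⟩
  | loop_done hb => exact ⟨∅, by simp, fun _ _ _ => rfl⟩
  | loop_step hb _ _ h₁ h₂ =>
    obtain ⟨S, hS, h₁⟩ := h₁
    obtain ⟨S', hS', h₂⟩ := h₂
    refine ⟨S ∪ S', (Finset.card_union_le _ _).trans (by omega), fun a i hi => ?_⟩
    simp only [Finset.mem_union, not_or] at hi
    rw [h₂ a i hi.2, h₁ a i hi.1]

/-! ### Renaming the arrays of a program -/

def WExp.rename (f : ℕ → ℕ) : WExp → WExp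
  | .const c => .const c
  | .get a e => .get (f a) (e.rename f)
  | .add e g => .add (e.rename f) (g.rename f)
  | .sub e g => .sub (e.rename f) (g.rename f)
  | .mul e g => .mul (e.rename f) (g.rename f)
  | .div e g => .div (e.rename f) (g.rename f)

def RExp.rename (f : ℕ → ℕ) : RExp → RExp
  | .get a e => .get (f a) (e.rename f)
  | .cast e => .cast (e.rename f)
  | .add e g => .add (e.rename f) (g.rename f)
  | .sub e g => .sub (e.rename f) (g.rename f)
  | .mul e g => .mul (e.rename f) (g.rename f)
  | .div e g => .div (e.rename f) (g.rename f)
  | .exp e => .exp (e.rename f)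
  | .ln e => .ln (e.rename f)

def Test.rename (f : ℕ → ℕ) : Test → Test
  | .wlt e g => .wlt (e.rename f) (g.rename f)
  | .rlt e g => .rlt (e.rename f) (g.rename f)

def Prog.rename (f : ℕ → ℕ) : Prog → Prog
  | .skip => .skip
  | .wset a i e => .wset (f a) (i.rename f) (e.rename f)
  | .rset a i e => .rset (f a) (i.rename f) (e.rename f)
  | .seq p q => .seq (p.rename f) (q.rename f)
  | .ite b p q => .ite (b.rename f) (p.rename f) (q.rename f)
  | .loop b p => .loop (b.rename f) (p.rename f)

/-- The memory seen by a program whose arrays are renamed by `f`. -/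
def State.pull (f : ℕ → ℕ) (τ : State) : State := ⟨fun a => τ.w (f a), fun a => τ.r (f a)⟩

theorem WExp.eval_rename (f : ℕ → ℕ) (τ : State) (e : WExp) :
    (e.rename f).eval τ = e.eval (τ.pull f) := by
  induction e <;> simp_all [WExp.rename, WExp.eval, State.pull]

theorem RExp.eval_rename (f : ℕ → ℕ) (τ : State) (e : RExp) :
    (e.rename f).eval τ = e.eval (τ.pull f) := by
  induction e <;> simp_all [RExp.rename, RExp.eval, WExp.eval_rename, State.pull]

theorem Test.holds_rename (f : ℕ → ℕ) (τ : State) (b : Test) :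
    (b.rename f).Holds τ ↔ b.Holds (τ.pull f) := by
  cases b <;> simp [Test.rename, Test.Holds, WExp.eval_rename, RExp.eval_rename]

/-- Injectivity is essential: otherwise a write to the array `f a` would also be seen under another
name. -/
theorem State.pull_setW {f : ℕ → ℕ} (hf : f.Injective) (τ : State) (a i v : ℕ) :
    (τ.setW (f a) i v).pull f = (τ.pull f).setW a i v := by
  ext b j
  · by_cases hb : b = a
    · subst hb; simp [State.pull, State.setW]
    · simp [State.pull, State.setW, hb, hf.ne hb]
  · rfl

theorem State.pull_setR {f : ℕ → ℕ} (hf : f.Injective) (τ : State) (a i : ℕ) (v : ℝ) :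
    (τ.setR (f a) i v).pull f = (τ.pull f).setR a i v := by
  ext b j
  · rfl
  · by_cases hb : b = a
    · subst hb; simp [State.pull, State.setR]
    · simp [State.pull, State.setR, hb, hf.ne hb]

/-- A renamed program does on the renamed arrays what the program does, and leaves all other arrays
unchanged. -/
theorem Exec.rename {f : ℕ → ℕ} (hf : f.Injective) {B : ℕ} {p : Prog} {σ σ' : State} {t : ℕ}
    (h : Exec B p σ σ' t) : ∀ τ : State, τ.pull f = σ →
      ∃ τ' : State, Exec B (p.rename f) τ τ' t ∧ τ'.pull f = σ' ∧
        (∀ b, b ∉ Set.range f → τ'.w b = τ.w b) ∧ (∀ b, b ∉ Set.range f → τ'.r b = τ.r b) := by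
  induction h with
  | skip σ => exact fun τ h => ⟨τ, .skip τ, h, fun _ _ => rfl, fun _ _ => rfl⟩
  | wset σ a i e h =>
    rintro τ rfl
    refine ⟨_, .wset τ _ _ _ (by rwa [WExp.eval_rename]), ?_, fun b hb => ?_, fun _ _ => rfl⟩
    · rw [State.pull_setW hf, WExp.eval_rename, WExp.eval_rename]
    · exact State.setW_w_ne _ _ _ (by rintro rfl; simp at hb)
  | rset σ a i e =>
    rintro τ rfl
    refine ⟨_, .rset τ _ _ _, ?_, fun _ _ => rfl, fun b hb => ?_⟩
    · rw [State.pull_setR hf, WExp.eval_rename, RExp.eval_rename]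
    · exact State.setR_r_ne _ _ _ (by rintro rfl; simp at hb)
  | seq _ _ h₁ h₂ =>
    intro τ hτ
    obtain ⟨τ₁, e₁, p₁, w₁, r₁⟩ := h₁ τ hτ
    obtain ⟨τ₂, e₂, p₂, w₂, r₂⟩ := h₂ τ₁ p₁
    exact ⟨τ₂, .seq e₁ e₂, p₂, fun b hb => (w₂ b hb).trans (w₁ b hb),
      fun b hb => (r₂ b hb).trans (r₁ b hb)⟩
  | ite_true hb _ h =>
    rintro τ rfl
    obtain ⟨τ₁, e₁, h₁⟩ := h τ rfl
    exact ⟨τ₁, .ite_true ((Test.holds_rename _ _ _).2 hb) e₁, h₁⟩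
  | ite_false hb _ h =>
    rintro τ rfl
    obtain ⟨τ₁, e₁, h₁⟩ := h τ rfl
    exact ⟨τ₁, .ite_false (mt (Test.holds_rename _ _ _).1 hb) e₁, h₁⟩
  | loop_done hb =>
    rintro τ rfl
    exact ⟨τ, .loop_done (mt (Test.holds_rename _ _ _).1 hb), rfl, fun _ _ => rfl, fun _ _ => rfl⟩
  | loop_step hb _ _ h₁ h₂ =>
    rintro τ rfl
    obtain ⟨τ₁, e₁, p₁, w₁, r₁⟩ := h₁ τ rfl
    obtain ⟨τ₂, e₂, p₂, w₂, r₂⟩ := h₂ τ₁ p₁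
    exact ⟨τ₂, .loop_step ((Test.holds_rename _ _ _).2 hb) e₁ e₂, p₂,
      fun b hb => (w₂ b hb).trans (w₁ b hb), fun b hb => (r₂ b hb).trans (r₁ b hb)⟩

/-! ### Total correctness with time bounds -/

/-- Started in `σ`, the program `p` halts after at most `T` steps in a state that satisfies `Q`. -/
def Run (B : ℕ) (p : Prog) (σ : State) (T : ℕ) (Q : State → Prop) : Prop :=
  ∃ (σ' : State) (t : ℕ), Exec B p σ σ' t ∧ t ≤ T ∧ Q σ'

namespace Run

variable {B : ℕ} {p q : Prog} {σ : State} {T T' : ℕ} {Q Q' : State → Prop}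

theorem mono (h : Run B p σ T Q) (hT : T ≤ T') (hQ : ∀ τ, Q τ → Q' τ) : Run B p σ T' Q' := by
  obtain ⟨σ', t, e, ht, h⟩ := h
  exact ⟨σ', t, e, ht.trans hT, hQ _ h⟩

theorem seq (h : Run B p σ T (fun τ => Run B q τ T' Q)) : Run B (.seq p q) σ (T + T') Q := by
  obtain ⟨σ₁, t₁, e₁, h₁, σ₂, t₂, e₂, h₂, hQ⟩ := h
  exact ⟨σ₂, _, .seq e₁ e₂, by omega, hQ⟩

theorem wset {a : ℕ} {i e : WExp} (h : e.eval σ < B) (hQ : Q (σ.setW a (i.eval σ) (e.eval σ))) :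
    Run B (.wset a i e) σ 1 Q :=
  ⟨_, _, .wset σ a i e h, le_rfl, hQ⟩

theorem rset {a : ℕ} {i : WExp} {e : RExp} (hQ : Q (σ.setR a (i.eval σ) (e.eval σ))) :
    Run B (.rset a i e) σ 1 Q :=
  ⟨_, _, .rset σ a i e, le_rfl, hQ⟩

/-- The index of the invariant counts the rounds already done; induction goes downwards from `k`,
where the test fails. Each round pays one step for its test, and the final test pays one more. -/
theorem loop {b : Test} {I : ℕ → State → Prop} {k : ℕ}
    (hlt : ∀ x < k, ∀ τ, I x τ → b.Holds τ) (hk : ∀ τ, I k τ → ¬ b.Holds τ)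
    (hstep : ∀ x < k, ∀ τ, I x τ → Run B p τ T (I (x + 1))) :
    ∀ x ≤ k, ∀ τ, I x τ → Run B (.loop b p) τ ((k - x) * (T + 1) + 1) (I k) := by
  intro x hx
  induction hx using Nat.decreasingInduction with
  | self => exact fun τ hτ => ⟨τ, 1, .loop_done (hk τ hτ), by omega, hτ⟩
  | of_succ x hx ih =>
    intro τ hτ
    obtain ⟨τ₁, t₁, e₁, ht₁, h₁⟩ := hstep x hx τ hτ
    obtain ⟨τ₂, t₂, e₂, ht₂, h₂⟩ := ih τ₁ h₁
    refine ⟨τ₂, _, .loop_step (hlt x hx τ hτ) e₁ e₂, ?_, h₂⟩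
    obtain ⟨y, rfl⟩ : ∃ y, k = x + 1 + y := ⟨k - (x + 1), by omega⟩
    have e1 : x + 1 + y - (x + 1) = y := by omega
    have e2 : x + 1 + y - x = y + 1 := by omega
    rw [e1] at ht₂
    rw [e2, add_mul]
    omega

end Run

/-- `for c := 0, …, K - 1 do p`, with the counter in cell `0` of word array `c`. -/
def forLoop (c : ℕ) (K : WExp) (p : Prog) : Prog :=
  .seq (.wset c (.const 0) (.const 0))
    (.loop (.wlt (.get c (.const 0)) K)
      (.seq p (.wset c (.const 0) (.add (.get c (.const 0)) (.const 1)))))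

/-- The limit `K` is evaluated again at every test, so the invariant has to keep its value fixed.
The body must restore the counter, and the next invariant is required only after the increment. The
extra steps are test and increment in each round, and initialisation and last test once. The counter
reaches `k` itself, hence `k < B`. -/
theorem Run.forLoop {B : ℕ} {c : ℕ} {K : WExp} {p : Prog} {σ : State} {T k : ℕ}
    (I : ℕ → State → Prop) (hB : k < B) (h0 : I 0 (σ.setW c 0 0))
    (hI : ∀ x ≤ k, ∀ τ, I x τ → τ.w c 0 = x ∧ K.eval τ = k)
    (hstep : ∀ x < k, ∀ τ, I x τ →
      Run B p τ T (fun τ' => τ'.w c 0 = x ∧ I (x + 1) (τ'.setW c 0 (x + 1)))) :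
    Run B (forLoop c K p) σ (k * (T + 2) + 2) (I k) := by
  have key := Run.loop (B := B) (b := .wlt (.get c (.const 0)) K) (I := I) (k := k)
    (p := .seq p (.wset c (.const 0) (.add (.get c (.const 0)) (.const 1)))) (T := T + 1)
    (fun x hx τ hτ => by
      obtain ⟨h1, h2⟩ := hI x hx.le τ hτ
      simpa [Test.Holds, WExp.eval, h1, h2] using hx)
    (fun τ hτ => by
      obtain ⟨h1, h2⟩ := hI k le_rfl τ hτ
      simp [Test.Holds, WExp.eval, h1, h2])
    (fun x hx τ hτ => Run.seq ((hstep x hx τ hτ).mono le_rfl fun τ' h =>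
      Run.wset (by simp only [WExp.eval, h.1]; omega) (by simpa [WExp.eval, h.1] using h.2)))
  have := Run.seq (B := B) (σ := σ) (T := 1) (p := .wset c (.const 0) (.const 0))
    (Run.wset (by simp only [WExp.eval]; omega) (key 0 (Nat.zero_le _) _ h0))
  exact this.mono (by simp only [Nat.sub_zero, add_assoc, Nat.reduceAdd]; omega) fun _ h => h

/-! ### Tabulating sums -/

/-- The word variables `x` and `u` used by `tabulate`. -/
def xVar : WExp := .get 10 (.const 0)

def uVar : WExp := .get 11 (.const 0)

/-- The real variable that holds the sum in `tabulate`. -/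
def acc : RExp := .get 10 (.const 0)

/-- For each `x < K₁`, compute the sum of `e` over all `u < K₂` and write `g` into cell `off + x` of
the real array `dst`. -/
def tabulate (dst : ℕ) (off K₁ K₂ : WExp) (e g : RExp) : Prog :=
  forLoop 10 K₁
    (.seq (.rset 10 (.const 0) (.cast (.const 0)))
      (.seq (forLoop 11 K₂ (.rset 10 (.const 0) (.add acc e)))
        (.rset dst (.add off xVar) g)))

/-- `τ` differs from `σ` at most in the variables of `tabulate` and in the real array `dst`. -/
structure TabFrame (dst : ℕ) (σ τ : State) : Prop where
  w : ∀ a, a ≠ 10 → a ≠ 11 → τ.w a = σ.w a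
  r : ∀ a, a ≠ 10 → a ≠ dst → τ.r a = σ.r a

/-- Correctness of `e` and `g` is only required in states that agree with `σ` outside the scratch
variables and `dst`. In addition `g` may rely on the old content of the cell it overwrites, which
permits updates in place. With `k₂ = 0` the sum is empty and the program merely copies. -/
theorem Run.tabulate {B dst : ℕ} {off K₁ K₂ : WExp} {e g : RExp} {σ : State} {o k₁ k₂ : ℕ}
    (E : ℕ → ℕ → ℝ) (G : ℕ → ℝ) (hdst : dst ≠ 10) (hB₁ : k₁ < B) (hB₂ : k₂ < B)
    (ho : ∀ τ, TabFrame dst σ τ → off.eval τ = o)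
    (hk₁ : ∀ τ, TabFrame dst σ τ → K₁.eval τ = k₁)
    (hk₂ : ∀ τ, TabFrame dst σ τ → K₂.eval τ = k₂)
    (he : ∀ τ, TabFrame dst σ τ → ∀ x < k₁, ∀ u < k₂, τ.w 10 0 = x → τ.w 11 0 = u →
      e.eval τ = E x u)
    (hg : ∀ τ, TabFrame dst σ τ → ∀ x < k₁, τ.w 10 0 = x →
      τ.r 10 0 = ∑ u ∈ Finset.range k₂, E x u → τ.r dst (o + x) = σ.r dst (o + x) →
      g.eval τ = G x) :
    Run B (tabulate dst off K₁ K₂ e g) σ (k₁ * (3 * k₂ + 6) + 2) (fun τ =>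
      TabFrame dst σ τ ∧ (∀ x < k₁, τ.r dst (o + x) = G x) ∧
        ∀ y, (∀ x < k₁, y ≠ o + x) → τ.r dst y = σ.r dst y) := by
  have hB : 0 < B := by omega
  refine (Run.forLoop (T := 3 * k₂ + 4) (k := k₁) (fun k τ => τ.w 10 0 = k ∧ TabFrame dst σ τ ∧
    (∀ x < k, τ.r dst (o + x) = G x) ∧ ∀ y, (∀ x < k, y ≠ o + x) → τ.r dst y = σ.r dst y)
    hB₁ ?_ ?_ ?_).mono le_rfl fun τ h => h.2
  · refine ⟨by simp, ⟨fun a h _ => State.setW_w_ne _ _ _ h, fun a _ _ => rfl⟩, by simp, by simp⟩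
  · rintro x - τ ⟨h1, h2, -⟩
    exact ⟨h1, hk₁ τ h2⟩
  · rintro x hx τ ⟨hw, hF, hG, hrest⟩
    have hT : 3 * k₂ + 4 = 1 + ((k₂ * (1 + 2) + 2) + 1) := by ring
    rw [hT]
    refine Run.seq (Run.rset (Run.seq ((Run.forLoop (T := 1) (k := k₂) (fun k τ' =>
      τ'.w 11 0 = k ∧ τ'.w 10 0 = x ∧ TabFrame dst σ τ' ∧ τ'.r dst = τ.r dst ∧
        τ'.r 10 0 = ∑ u ∈ Finset.range k, E x u) hB₂ ?_ ?_ ?_).mono le_rfl ?_)))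
    · refine ⟨by simp, ?_, ⟨fun a h h' => ?_, fun a h h' => ?_⟩, ?_, ?_⟩
      · rw [State.setW_w_ne _ _ _ (by decide)]; simpa using hw
      · rw [State.setW_w_ne _ _ _ h', ← hF.w a h h']; rfl
      · rw [State.setW_r, State.setR_r_ne _ _ _ h, hF.r a h h']
      · rw [State.setW_r, State.setR_r_ne _ _ _ hdst]
      · simp [WExp.eval, RExp.eval]
    · rintro y - τ' ⟨h1, -, h2, -⟩
      exact ⟨h1, hk₂ τ' h2⟩
    · rintro u hu τ' ⟨h1, h2, h3, h4, h5⟩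
      refine Run.rset ⟨by simpa using h1, by simp, ?_, ⟨fun a h h' => ?_, fun a h h' => ?_⟩, ?_, ?_⟩
      · rw [State.setW_w_ne _ _ _ (by decide)]; simpa using h2
      · rw [State.setW_w_ne _ _ _ h', ← h3.w a h h']; rfl
      · rw [State.setW_r, State.setR_r_ne _ _ _ h, h3.r a h h']
      · rw [State.setW_r, State.setR_r_ne _ _ _ hdst, h4]
      · rw [Finset.sum_range_succ, ← h5, ← he τ' h3 x hx u hu h2 h1]
        simp [WExp.eval, RExp.eval, acc]
    · rintro τ' ⟨h1, h2, h3, h4, h5⟩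
      have hidx : (WExp.add off xVar).eval τ' = o + x := by
        simp [WExp.eval, xVar, ho τ' h3, h2]
      refine Run.rset ?_
      -- Earlier rounds wrote only the cells `o + y` with `y < x`, so the target cell still has its
      -- original value.
      rw [hidx, hg τ' h3 x hx h2 h5 (by
        rw [h4]; exact hrest _ fun y hy => by omega)]
      refine ⟨by simpa using h2, by simp, ⟨fun a h h' => ?_, fun a h h' => ?_⟩, fun y hy => ?_,
        fun y hy => ?_⟩
      · rw [State.setW_w_ne _ _ _ h, ← h3.w a h h']; rfl
      · rw [State.setW_r, State.setR_r_ne _ _ _ h', h3.r a h h']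
      · rcases (Nat.lt_succ_iff_lt_or_eq.1 hy) with hy | rfl
        · rw [State.setW_r, State.setR_r_cell_ne _ _ _ (by omega), h4, hG y hy]
        · simp
      · rw [State.setW_r, State.setR_r_cell_ne _ _ _ (hy x (by omega)), h4]
        exact hrest y fun z hz => hy z (by omega)

end RealRAM

namespace RealRAM

open TransformerFamily

/-! ### Calling the subroutines

The arrays `a` of the given programs are renamed to `4 * a`; the arrays whose names are not divisible
by `4` belong to the calling program. -/

def Prog.embedded (p : Prog) : Prog := p.rename (4 * ·)

theorem quad_injective : Function.Injective (fun a : ℕ => 4 * a) := fun a b h => by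
  simpa using h

theorem notMem_range_quad {b : ℕ} (h : ¬ 4 ∣ b) : b ∉ Set.range (fun a : ℕ => 4 * a) := by
  rintro ⟨a, rfl⟩
  exact h ⟨a, rfl⟩

/-- `Evaluates` tolerates arbitrary contents in the rest of memory, so nothing has to be cleared
between calls. Under the renaming, arguments are passed in arrays `4` and the value comes back in
real array `8`. -/
theorem run_embedded {B B' : ℕ} (hB : B ≤ B') {p : Prog} {σ₀ : State} {i j a b S : ℕ}
    {x : Fin a → ℝ} {y : Fin b → ℝ} (h : Evaluates B p σ₀ i j x y S) {τ : State}
    (hw : τ.w 0 = σ₀.w 0) (hr : τ.r 0 = σ₀.r 0) (hi : τ.w 4 0 = i) (hj : τ.w 4 1 = j)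
    (hx : ∀ u : Fin a, τ.r 4 u = x u) :
    Run B' p.embedded τ S (fun τ' => τ'.w 0 = σ₀.w 0 ∧ τ'.r 0 = σ₀.r 0 ∧
      (∀ u : Fin b, τ'.r 8 u = y u) ∧ (∀ a, ¬ 4 ∣ a → τ'.w a = τ.w a) ∧
      ∀ a, ¬ 4 ∣ a → τ'.r a = τ.r a) := by
  obtain ⟨σ', t, e, ht, h0, h1, h2⟩ := h (τ.pull (4 * ·)) hw hr hi hj hx
  obtain ⟨τ', e', rfl, hw', hr'⟩ := e.rename quad_injective τ rfl
  exact ⟨τ', t, e'.mono hB, ht, h0, h1, h2, fun a ha => hw' a (notMem_range_quad ha),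
    fun a ha => hr' a (notMem_range_quad ha)⟩

/-- The array `f` holds the matrix `X`, row by row. -/
def Stores (f : ℕ → ℝ) {N m : ℕ} (X : Matrix (Fin N) (Fin m) ℝ) : Prop :=
  ∀ (i : Fin N) (u : Fin m), f (i * m + u) = X i u

/-- The parameter in cell `k` of word array `0`. -/
def par (k : ℕ) : WExp := .get 0 (.const k)

def rowVar : WExp := .get 7 (.const 0)

/-- Apply the subroutine `p`, with integer arguments `ei` and `ej`, to each row of the matrix in the
real array `src`; the rows have length `a`, and the values, of length `b`, are written into `dst`. -/
def applyRows (p : Prog) (src dst : ℕ) (ei ej a b : WExp) : Prog :=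
  forLoop 7 (par 2)
    (.seq (.wset 4 (.const 0) ei)
    (.seq (.wset 4 (.const 1) ej)
    (.seq (tabulate 4 (.const 0) a (.const 0) (.cast (.const 0)) (.get src (.add (.mul rowVar a) xVar)))
    (.seq p.embedded
      (tabulate dst (.mul rowVar b) b (.const 0) (.cast (.const 0)) (.get 8 xVar))))))

/-- `τ` differs from `σ` at most in the variables of `applyRows` and in the real array `dst`. -/
structure RowsFrame (dst : ℕ) (σ τ : State) : Prop where
  w0 : τ.w 0 = σ.w 0
  r0 : τ.r 0 = σ.r 0
  w : ∀ a, ¬ 4 ∣ a → a ≠ 7 → a ≠ 10 → a ≠ 11 → τ.w a = σ.w a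
  r : ∀ a, ¬ 4 ∣ a → a ≠ 10 → a ≠ dst → τ.r a = σ.r a

/-- The integer arguments may depend only on the parameters and on the counters of layer, head and
row, all of which survive each call because `5`, `6`, `7` are not multiples of `4`. -/
theorem run_applyRows {B B' : ℕ} (hBB : B ≤ B') {p : Prog} {src dst : ℕ} {ei ej ea eb : WExp}
    {N a b S : ℕ} {σ₀ σ : State} {i j : ℕ → ℕ} {x : Matrix (Fin N) (Fin a) ℝ}
    {y : Matrix (Fin N) (Fin b) ℝ}
    (hsrc : ¬ 4 ∣ src) (hsrc' : src ≠ 10) (hdst : ¬ 4 ∣ dst) (hdst' : dst ≠ 10) (hne : src ≠ dst)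
    (hw : σ.w 0 = σ₀.w 0) (hr : σ.r 0 = σ₀.r 0) (hN : σ₀.w 0 2 = N)
    (hp : ∀ t : Fin N, Evaluates B p σ₀ (i t) (j t) (x t) (y t) S)
    (hx : Stores (σ.r src) x) (hBN : N < B') (hBa : a < B') (hBb : b < B')
    (hBi : ∀ t < N, i t < B') (hBj : ∀ t < N, j t < B')
    (hei : ∀ τ : State, τ.w 0 = σ.w 0 → τ.w 5 = σ.w 5 → τ.w 6 = σ.w 6 → ei.eval τ = i (τ.w 7 0))
    (hej : ∀ τ : State, τ.w 0 = σ.w 0 → τ.w 5 = σ.w 5 → τ.w 6 = σ.w 6 → ej.eval τ = j (τ.w 7 0))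
    (hea : ∀ τ : State, τ.w 0 = σ.w 0 → ea.eval τ = a)
    (heb : ∀ τ : State, τ.w 0 = σ.w 0 → eb.eval τ = b) :
    Run B' (applyRows p src dst ei ej ea eb) σ (N * (6 * a + 6 * b + S + 8) + 2) (fun τ =>
      RowsFrame dst σ τ ∧ Stores (τ.r dst) y) := by
  have h4 : dst ≠ 4 := by rintro rfl; simp at hdst
  have h0 : dst ≠ 0 := by rintro rfl; simp at hdst
  have h8 : dst ≠ 8 := by rintro rfl; simp at hdst
  have hs4 : src ≠ 4 := by rintro rfl; simp at hsrc
  refine (Run.forLoop (T := 6 * a + 6 * b + S + 6) (k := N) (fun k τ => τ.w 7 0 = k ∧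
    RowsFrame dst σ τ ∧ ∀ (t : Fin N) (u : Fin b), t.val < k → τ.r dst (t * b + u) = y t u)
    hBN ?_ ?_ ?_).mono le_rfl fun τ h => ⟨h.2.1, fun t u => h.2.2 t u t.2⟩
  · exact ⟨by simp, ⟨State.setW_w_ne _ _ _ (by decide), rfl,
      fun a _ h7 _ _ => State.setW_w_ne _ _ _ h7, fun a _ _ _ => rfl⟩, fun t u h => by simp at h⟩
  · rintro k - τ ⟨h1, h2, -⟩
    exact ⟨h1, by simp [par, WExp.eval, h2.w0, hw, hN]⟩
  · rintro k hk τ ⟨hw7, hF, hy⟩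
    have hT : 6 * a + 6 * b + S + 6 =
        1 + (1 + ((a * (3 * 0 + 6) + 2) + (S + (b * (3 * 0 + 6) + 2)))) := by ring
    rw [hT]
    refine Run.seq (Run.wset ?_ (Run.seq (Run.wset ?_ ?_)))
    · rw [hei τ hF.w0 (hF.w 5 (by decide) (by decide) (by decide) (by decide))
        (hF.w 6 (by decide) (by decide) (by decide) (by decide)), hw7]
      exact hBi k hk
    · rw [hej, State.setW_w_ne _ _ _ (by decide), hw7]
      · exact hBj k hk
      · rw [State.setW_w_ne _ _ _ (by decide), hF.w0]
      · rw [State.setW_w_ne _ _ _ (by decide), hF.w 5] <;> decide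
      · rw [State.setW_w_ne _ _ _ (by decide), hF.w 6] <;> decide
    have hi1 : ei.eval τ = i k := by
      rw [hei τ hF.w0 (hF.w 5 (by decide) (by decide) (by decide) (by decide))
        (hF.w 6 (by decide) (by decide) (by decide) (by decide)), hw7]
    rw [hi1]
    have hj1 : ej.eval (τ.setW 4 (WExp.eval τ (.const 0)) (i k)) = j k := by
      rw [hej, State.setW_w_ne _ _ _ (by decide), hw7]
      · rw [State.setW_w_ne _ _ _ (by decide), hF.w0]
      · rw [State.setW_w_ne _ _ _ (by decide), hF.w 5] <;> decide
      · rw [State.setW_w_ne _ _ _ (by decide), hF.w 6] <;> decide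
    rw [hj1]
    simp only [WExp.eval]
    obtain ⟨τ₁, hτ₁⟩ : ∃ τ₁, τ₁ = (τ.setW 4 0 (i k)).setW 4 1 (j k) := ⟨_, rfl⟩
    rw [← hτ₁]
    have hw1 : ∀ c, c ≠ 4 → τ₁.w c = τ.w c := fun c hc => by
      rw [hτ₁, State.setW_w_ne _ _ _ hc, State.setW_w_ne _ _ _ hc]
    have hr1 : τ₁.r = τ.r := by rw [hτ₁]; rfl
    have h40 : τ₁.w 4 0 = i k := by
      rw [hτ₁, State.setW_w_cell_ne _ _ _ (by decide), State.setW_w_self]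
    have h41 : τ₁.w 4 1 = j k := by rw [hτ₁, State.setW_w_self]
    clear hτ₁
    have hsrcx : τ₁.r src = σ.r src := by rw [hr1, hF.r src hsrc hsrc' hne]
    -- A tabulation with empty sums, used to copy row `k` into the argument array.
    refine Run.seq ((Run.tabulate (B := B') (o := 0) (k₁ := a) (k₂ := 0) (fun _ _ => 0)
      (fun u => σ.r src (k * a + u)) (by decide) hBa (by omega) (fun _ _ => rfl) (fun τ' h => ?_)
      (fun _ _ => rfl) (fun _ _ _ _ u hu => absurd hu (by omega)) ?_).mono le_rfl ?_)
    · exact hea τ' (by rw [h.w 0 (by decide) (by decide), hw1 0 (by decide), hF.w0])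
    · intro τ' h u hu h10 _ _
      simp only [RExp.eval, WExp.eval, rowVar, xVar]
      rw [h10, hea τ' (by rw [h.w 0 (by decide) (by decide), hw1 0 (by decide), hF.w0]),
        h.r src hsrc' hs4, hsrcx, h.w 7 (by decide) (by decide), hw1 7 (by decide), hw7]
    rintro τ₂ ⟨hF₂, hG₂, -⟩
    refine Run.seq ((run_embedded hBB (hp ⟨k, hk⟩) (τ := τ₂) ?_ ?_ ?_ ?_ ?_).mono le_rfl ?_)
    · rw [hF₂.w 0 (by decide) (by decide), hw1 0 (by decide), hF.w0, hw]
    · rw [hF₂.r 0 (by decide) (by decide), hr1, hF.r0, hr]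
    · rw [hF₂.w 4 (by decide) (by decide), h40]
    · rw [hF₂.w 4 (by decide) (by decide), h41]
    · intro u
      have := hG₂ u u.2
      rw [zero_add] at this
      rw [this]
      exact hx ⟨k, hk⟩ u
    rintro τ₃ ⟨hw3, hr3, hy3, hfw3, hfr3⟩
    refine (Run.tabulate (B := B') (o := k * b) (k₁ := b) (k₂ := 0) (fun _ _ => 0)
      (fun u => τ₃.r 8 u) hdst' hBb (by omega) (fun τ' h => ?_) (fun τ' h => ?_)
      (fun _ _ => rfl) (fun _ _ _ _ u hu => absurd hu (by omega)) ?_).mono le_rfl ?_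
    · rw [rowVar, WExp.eval, WExp.eval, WExp.eval,
        heb τ' (by rw [h.w 0 (by decide) (by decide), hw3, hw]), h.w 7 (by decide) (by decide),
        hfw3 7 (by decide), hF₂.w 7 (by decide) (by decide), hw1 7 (by decide), hw7]
    · exact heb τ' (by rw [h.w 0 (by decide) (by decide), hw3, hw])
    · intro τ' h u hu h10 _ _
      rw [RExp.eval, xVar, WExp.eval, WExp.eval, h10, h.r 8 (by decide) h8.symm]
    rintro τ₄ ⟨hF₄, hG₄, hrest⟩
    have hfw : ∀ c, ¬ 4 ∣ c → c ≠ 10 → c ≠ 11 → τ₄.w c = τ.w c := fun c hc h10 h11 => by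
      rw [hF₄.w c h10 h11, hfw3 c hc, hF₂.w c h10 h11, hw1 c (by rintro rfl; simp at hc)]
    have hfr : ∀ c, ¬ 4 ∣ c → c ≠ 10 → c ≠ dst → τ₄.r c = τ.r c := fun c hc h10 hd => by
      rw [hF₄.r c h10 hd, hfr3 c hc, hF₂.r c h10 (by rintro rfl; simp at hc), hr1]
    refine ⟨by rw [hfw 7 (by decide) (by decide) (by decide), hw7], by simp, ⟨?_, ?_,
      fun c hc h7 h10 h11 => ?_, fun c hc h10 hd => ?_⟩, fun t u ht => ?_⟩
    · rw [State.setW_w_ne _ _ _ (by decide), hF₄.w 0 (by decide) (by decide), hw3, hw]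
    · rw [State.setW_r, hF₄.r 0 (by decide) h0.symm, hr3, hr]
    · rw [State.setW_w_ne _ _ _ h7, hfw c hc h10 h11, hF.w c hc h7 h10 h11]
    · rw [State.setW_r, hfr c hc h10 hd, hF.r c hc h10 hd]
    · rw [State.setW_r]
      rcases Nat.lt_succ_iff_lt_or_eq.1 ht with ht | rfl
      -- Rows before `k` occupy cells below `k * b`, where the last copy does not write.
      · rw [hrest, hfr3 dst hdst, hF₂.r dst hdst' h4, hr1, hy t u ht]
        intro z hz
        have h1 := u.2
        have h2 : (t.val + 1) * b ≤ k * b := Nat.mul_le_mul_right _ ht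
        rw [add_mul] at h2
        omega
      · rw [hG₄ u u.2, hy3]

/-! ### The attention head -/

/-- `x % y` -/
def WExp.mod (e f : WExp) : WExp := .sub e (.mul f (.div e f))

theorem WExp.eval_mod (σ : State) (e f : WExp) : (e.mod f).eval σ = e.eval σ % f.eval σ := by
  simp only [WExp.mod, WExp.eval]
  exact (Nat.mod_eq_sub ..).symm

/-- Add `softmax(Q Kᵀ) V` to the matrix in real array `3`, where `Q`, `K`, `V` are in the real arrays
`5`, `6`, `7`. -/
def attend : Prog :=
  .seq (tabulate 9 (.const 0) (.mul (par 2) (par 2)) (par 5)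
      (.mul (.get 5 (.add (.mul (.div xVar (par 2)) (par 5)) uVar))
        (.get 6 (.add (.mul (xVar.mod (par 2)) (par 5)) uVar)))
      (.exp acc))
  (.seq (tabulate 11 (.const 0) (par 2) (par 2) (.get 9 (.add (.mul xVar (par 2)) uVar)) acc)
    (tabulate 3 (.const 0) (.mul (par 2) (par 5)) (par 2)
      (.mul (.div (.get 9 (.add (.mul (.div xVar (par 5)) (par 2)) uVar))
          (.get 11 (.div xVar (par 5))))
        (.get 7 (.add (.mul uVar (par 5)) (xVar.mod (par 5)))))
      (.add (.get 3 xVar) acc)))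

theorem flat_lt {N m : ℕ} (i : Fin N) (u : Fin m) : i.val * m + u < N * m := by
  have h1 : (i.val + 1) * m ≤ N * m := Nat.mul_le_mul_right _ i.2
  have h2 := u.2
  rw [add_mul] at h1
  omega

theorem flat_div {m : ℕ} (i : ℕ) (u : Fin m) : (i * m + u) / m = i := by
  have h : 0 < m := u.pos
  rw [mul_comm, Nat.mul_add_div h, Nat.div_eq_of_lt u.2, add_zero]

theorem flat_mod {m : ℕ} (i : ℕ) (u : Fin m) : (i * m + u) % m = u := by
  rw [mul_comm, Nat.mul_add_mod, Nat.mod_eq_of_lt u.2]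

/-- Three tables: the exponentials in array `9`, their row sums in array `11`, and the normalised
weighted sums added to array `3`. A cell `x` of a flattened matrix is decoded into row and column by
division and remainder. The real array `11` does not clash with the loop counter in the word array
`11`. -/
theorem run_attend {B N m : ℕ} {σ : State} {Q K V Y : Matrix (Fin N) (Fin m) ℝ}
    (hN : σ.w 0 2 = N) (hm : σ.w 0 5 = m) (hQ : Stores (σ.r 5) Q) (hK : Stores (σ.r 6) K)
    (hV : Stores (σ.r 7) V) (hY : Stores (σ.r 3) Y) (hBN : N < B) (hBm : m < B)
    (hNN : N * N < B) (hNm : N * m < B) :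
    Run B attend σ (N * N * (3 * m + 6) + 2 + (N * (3 * N + 6) + 2 + (N * m * (3 * N + 6) + 2)))
      (fun τ => (∀ a, a ≠ 10 → a ≠ 11 → τ.w a = σ.w a) ∧
        (∀ a, a ≠ 3 → a ≠ 9 → a ≠ 10 → a ≠ 11 → τ.r a = σ.r a) ∧
        Stores (τ.r 3) (Y + rowwise softmax (Q * Kᵀ) * V)) := by
  refine Run.seq ((Run.tabulate (B := B) (o := 0) (k₁ := N * N) (k₂ := m)
    (fun x u => σ.r 5 (x / N * m + u) * σ.r 6 (x % N * m + u))
    (fun x => Real.exp (∑ u ∈ Finset.range m, σ.r 5 (x / N * m + u) * σ.r 6 (x % N * m + u)))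
    (by decide) hNN hBm (fun _ _ => rfl) (fun τ h => ?_) (fun τ h => ?_) ?_ ?_).mono le_rfl ?_)
  · simp [WExp.eval, par, h.w 0, hN]
  · simp [WExp.eval, par, h.w 0, hm]
  · intro τ h x hx u hu h1 h2
    simp [RExp.eval, WExp.eval, WExp.eval_mod, par, xVar, uVar, h1, h2, h.w 0, h.r 5, h.r 6, hN, hm]
  · intro τ h x hx h1 h2 _
    simp [RExp.eval, acc, WExp.eval, h2]
  rintro τ₁ ⟨hF₁, hG₁, -⟩
  simp only [zero_add] at hG₁
  refine Run.seq ((Run.tabulate (B := B) (o := 0) (k₁ := N) (k₂ := N)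
    (fun x u => τ₁.r 9 (x * N + u)) (fun x => ∑ u ∈ Finset.range N, τ₁.r 9 (x * N + u))
    (by decide) hBN hBN (fun _ _ => rfl) (fun τ h => ?_) (fun τ h => ?_) ?_ ?_).mono le_rfl ?_)
  · simp [WExp.eval, par, h.w 0, hF₁.w 0, hN]
  · simp [WExp.eval, par, h.w 0, hF₁.w 0, hN]
  · intro τ h x hx u hu h1 h2
    simp [RExp.eval, WExp.eval, par, xVar, uVar, h1, h2, h.w 0, hF₁.w 0, h.r 9, hN]
  · intro τ h x hx h1 h2 _
    simp [RExp.eval, acc, WExp.eval, h2]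
  rintro τ₂ ⟨hF₂, hG₂, -⟩
  simp only [zero_add] at hG₂
  have h29 : τ₂.r 9 = τ₁.r 9 := hF₂.r 9 (by decide) (by decide)
  -- This table is updated in place: the summand `σ.r 3 x` is the old content of the cell being
  -- written.
  refine (Run.tabulate (B := B) (o := 0) (k₁ := N * m) (k₂ := N)
    (fun x u => τ₁.r 9 (x / m * N + u) / τ₂.r 11 (x / m) * σ.r 7 (u * m + x % m))
    (fun x => σ.r 3 x +
      ∑ u ∈ Finset.range N, τ₁.r 9 (x / m * N + u) / τ₂.r 11 (x / m) * σ.r 7 (u * m + x % m))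
    (by decide) hNm hBN (fun _ _ => rfl) (fun τ h => ?_) (fun τ h => ?_) ?_ ?_).mono le_rfl ?_
  · simp [WExp.eval, par, h.w 0, hF₁.w 0, hF₂.w 0, hN, hm]
  · simp [WExp.eval, par, h.w 0, hF₁.w 0, hF₂.w 0, hN]
  · intro τ h x hx u hu h1 h2
    simp [RExp.eval, WExp.eval, WExp.eval_mod, par, xVar, uVar, h1, h2, h.w 0, hF₁.w 0, hF₂.w 0,
      h.r 9, h.r 11, h.r 7, hF₂.r 7, hF₁.r 7, h29, hN, hm]
  · intro τ h x hx h1 h2 h3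
    rw [zero_add, hF₂.r 3 (by decide) (by decide), hF₁.r 3 (by decide) (by decide)] at h3
    simp [RExp.eval, acc, xVar, WExp.eval, h1, h2, h3]
  rintro τ₃ ⟨hF₃, hG₃, -⟩
  simp only [zero_add] at hG₃
  refine ⟨fun a h h' => by rw [hF₃.w a h h', hF₂.w a h h', hF₁.w a h h'],
    fun a h3 h9 h10 h11 => by rw [hF₃.r a h10 h3, hF₂.r a h10 h11, hF₁.r a h10 h9],
    fun i u => ?_⟩
  have h9 : ∀ i j : Fin N, τ₁.r 9 (i * N + j) = Real.exp ((Q * Kᵀ) i j) := fun i j => by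
    rw [hG₁ _ (flat_lt i j), flat_div, flat_mod, Finset.sum_range, Matrix.mul_apply]
    simp [hQ i, hK j]
  rw [hG₃ _ (flat_lt i u), flat_div, flat_mod, hY, Finset.sum_range, Matrix.add_apply,
    Matrix.mul_apply, hG₂ i i.2, Finset.sum_range]
  simp only [h9, hV _ u, rowwise, softmax, Matrix.of_apply]

end RealRAM

namespace RealRAM

open TransformerFamily

/-! ### The standard evaluation algorithm -/

def layerVar : WExp := .get 5 (.const 0)

def headVar : WExp := .get 6 (.const 0)

/-- Add the value of an attention head to the matrix in real array `3`. -/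
def headProg (pq pk pv : Prog) : Prog :=
  .seq (applyRows pq 1 5 layerVar headVar (par 5) (par 5))
  (.seq (applyRows pk 1 6 layerVar headVar (par 5) (par 5))
  (.seq (applyRows pv 1 7 layerVar headVar (par 5) (par 5)) attend))

/-- Replace the embeddings in real array `1` by those of the next layer. -/
def layerProg (pq pk pv pm : Prog) : Prog :=
  .seq (tabulate 3 (.const 0) (.mul (par 2) (par 5)) (.const 0) (.cast (.const 0)) (.get 1 xVar))
  (.seq (forLoop 6 (par 4) (headProg pq pk pv))
    (applyRows pm 3 1 layerVar (.const 0) (par 5) (par 5)))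

/-- Evaluate the transformer on the matrix in real array `1`. -/
def evalProg (pq pk pv pm po : Prog) : Prog :=
  .seq (forLoop 5 (par 3) (layerProg pq pk pv pm))
    (applyRows po 1 2 (.const 0) (.const 0) (par 5) (par 6))

/-- The memory `σ₀` holds the sizes and weights of the transformer `T`, and the five programs compute
its maps in time `S`, with words smaller than `B`. -/
structure Implements {L H m dout : ℕ} (T : Transformer L H m dout) (N B S : ℕ) (σ₀ : State)
    (pq pk pv pm po : Prog) : Prop where
  N_eq : σ₀.w 0 2 = N
  L_eq : σ₀.w 0 3 = L
  H_eq : σ₀.w 0 4 = H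
  m_eq : σ₀.w 0 5 = m
  dout_eq : σ₀.w 0 6 = dout
  query : ∀ (l : Fin L) (h : Fin H) x, Evaluates B pq σ₀ l h x (T.query l h x) S
  key : ∀ (l : Fin L) (h : Fin H) x, Evaluates B pk σ₀ l h x (T.key l h x) S
  value : ∀ (l : Fin L) (h : Fin H) x, Evaluates B pv σ₀ l h x (T.value l h x) S
  mlp : ∀ (l : Fin L) x, Evaluates B pm σ₀ l 0 x (T.mlp l x) S
  out : ∀ x, Evaluates B po σ₀ 0 0 x (T.out x) S

/-- All sizes are words. -/
structure SizesLT (N L H m dout B : ℕ) : Prop where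
  N_lt : N < B
  L_lt : L < B
  H_lt : H < B
  m_lt : m < B
  dout_lt : dout < B
  NN_lt : N * N < B
  Nm_lt : N * m < B

/-- All costs are expressed as multiples of `N * N * S`, where `S` bounds a subroutine call and the
vector lengths. Here `6 + 6 + 1 + 8 = 21`, and the final `2` brings it to `23`. -/
theorem rows_time_le {N a b S : ℕ} (hN : 0 < N) (hS : 0 < S) (ha : a ≤ S) (hb : b ≤ S) :
    N * (6 * a + 6 * b + S + 8) + 2 ≤ 23 * (N * N * S) := by
  have h1 : N * (6 * a + 6 * b + S + 8) ≤ N * (21 * S) := Nat.mul_le_mul_left _ (by omega)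
  have h2 : N * S ≤ N * N * S := Nat.mul_le_mul_right _ (Nat.le_mul_of_pos_left _ hN)
  have h3 : 0 < N * N * S := by positivity
  have h4 : N * (21 * S) = 21 * (N * S) := by ring
  omega

/-- Each of the three tables costs at most `9` units, and the three summands `2` cost `6`. A head
therefore costs `3 * 23 + 33 = 102`. -/
theorem attend_time_le {N m S : ℕ} (hN : 0 < N) (hS : 0 < S) (hm : m ≤ S) :
    N * N * (3 * m + 6) + 2 + (N * (3 * N + 6) + 2 + (N * m * (3 * N + 6) + 2)) ≤
      33 * (N * N * S) := by
  have h1 : N * N * (3 * m + 6) ≤ N * N * (9 * S) := Nat.mul_le_mul_left _ (by omega)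
  have h2 : N * (3 * N + 6) ≤ N * (9 * N) := Nat.mul_le_mul_left _ (by omega)
  have h3 : N * m * (3 * N + 6) ≤ N * S * (9 * N) :=
    Nat.mul_le_mul (Nat.mul_le_mul_left _ hm) (by omega)
  have h4 : N * N ≤ N * N * S := Nat.le_mul_of_pos_right _ hS
  have h5 : 0 < N * N * S := by positivity
  have e1 : N * N * (9 * S) = 9 * (N * N * S) := by ring
  have e2 : N * (9 * N) = 9 * (N * N) := by ring
  have e3 : N * S * (9 * N) = 9 * (N * N * S) := by ring
  omega

/-! ### Correctness and cost of a head, a layer and the whole transformer -/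

section

variable {L H m dout N B B' S : ℕ} {T : Transformer L H m dout} {σ₀ : State}
  {pq pk pv pm po : Prog}

theorem run_head (I : Implements T N B S σ₀ pq pk pv pm po) (hBB : B ≤ B')
    (hB : SizesLT N L H m dout B') (hN : 0 < N) (hS : 0 < S) (hmS : m ≤ S) {σ : State}
    {X Y : Matrix (Fin N) (Fin m) ℝ} (l : Fin L) (h : Fin H)
    (hw : σ.w 0 = σ₀.w 0) (hr : σ.r 0 = σ₀.r 0) (hl : σ.w 5 0 = l) (hh : σ.w 6 0 = h)
    (hX : Stores (σ.r 1) X) (hY : Stores (σ.r 3) Y) :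
    Run B' (headProg pq pk pv) σ (102 * (N * N * S)) (fun τ =>
      τ.w 0 = σ₀.w 0 ∧ τ.r 0 = σ₀.r 0 ∧ τ.w 5 = σ.w 5 ∧ τ.w 6 = σ.w 6 ∧ τ.r 1 = σ.r 1 ∧
      Stores (τ.r 3) (Y + attentionHead (T.query l h) (T.key l h) (T.value l h) X)) := by
  have ht := rows_time_le hN hS hmS hmS
  have ht' := attend_time_le hN hS hmS
  have hlB := l.2.trans hB.L_lt
  have hhB := h.2.trans hB.H_lt
  -- The three embedding maps are called in the same way, each reading `X` from array `1`, which
  -- must therefore survive the calls before it.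
  have hap : ∀ {p : Prog} {dst : ℕ} {y : Matrix (Fin N) (Fin m) ℝ} {τ : State},
      (∀ t : Fin N, Evaluates B p σ₀ l h (X t) (y t) S) → ¬ 4 ∣ dst → dst ≠ 10 → dst ≠ 1 →
      τ.w 0 = σ₀.w 0 → τ.r 0 = σ₀.r 0 → τ.w 5 = σ.w 5 → τ.w 6 = σ.w 6 → τ.r 1 = σ.r 1 →
      Run B' (applyRows p 1 dst layerVar headVar (par 5) (par 5)) τ
        (N * (6 * m + 6 * m + S + 8) + 2)
        (fun τ' => RowsFrame dst τ τ' ∧ Stores (τ'.r dst) y) := by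
    intro p dst y τ hp h4 h10 h1 hw hr h5 h6 hr1
    refine run_applyRows hBB (i := fun _ => l) (j := fun _ => h) (by decide) (by decide) h4 h10
      h1.symm hw hr I.N_eq hp (hr1 ▸ hX) hB.N_lt hB.m_lt hB.m_lt (fun _ _ => hlB) (fun _ _ => hhB)
      ?_ ?_ ?_ ?_
    · intro τ' _ h5' _
      simp [layerVar, WExp.eval, h5', h5, hl]
    · intro τ' _ _ h6'
      simp [headVar, WExp.eval, h6', h6, hh]
    · intro τ' h0
      simp [par, WExp.eval, h0, hw, I.m_eq]
    · intro τ' h0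
      simp [par, WExp.eval, h0, hw, I.m_eq]
  refine Run.mono (T := (N * (6 * m + 6 * m + S + 8) + 2) + ((N * (6 * m + 6 * m + S + 8) + 2) +
    ((N * (6 * m + 6 * m + S + 8) + 2) + (N * N * (3 * m + 6) + 2 + (N * (3 * N + 6) + 2 +
      (N * m * (3 * N + 6) + 2)))))) ?_ (by omega) fun τ h => h
  refine Run.seq ((hap (y := rowwise (T.query l h) X) (dst := 5) (fun t => I.query l h (X t))
    (by decide) (by decide) (by decide) hw hr rfl rfl rfl).mono le_rfl ?_)
  rintro τ₁ ⟨F₁, s₁⟩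
  have w51 : τ₁.w 5 = σ.w 5 := F₁.w 5 (by decide) (by decide) (by decide) (by decide)
  have w61 : τ₁.w 6 = σ.w 6 := F₁.w 6 (by decide) (by decide) (by decide) (by decide)
  have r11 : τ₁.r 1 = σ.r 1 := F₁.r 1 (by decide) (by decide) (by decide)
  refine Run.seq ((hap (y := rowwise (T.key l h) X) (dst := 6) (fun t => I.key l h (X t))
    (by decide) (by decide) (by decide) (F₁.w0.trans hw) (F₁.r0.trans hr) w51 w61 r11).mono
    le_rfl ?_)
  rintro τ₂ ⟨F₂, s₂⟩
  have w52 : τ₂.w 5 = σ.w 5 := (F₂.w 5 (by decide) (by decide) (by decide) (by decide)).trans w51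
  have w62 : τ₂.w 6 = σ.w 6 := (F₂.w 6 (by decide) (by decide) (by decide) (by decide)).trans w61
  have r12 : τ₂.r 1 = σ.r 1 := (F₂.r 1 (by decide) (by decide) (by decide)).trans r11
  refine Run.seq ((hap (y := rowwise (T.value l h) X) (dst := 7) (fun t => I.value l h (X t))
    (by decide) (by decide) (by decide) (F₂.w0.trans (F₁.w0.trans hw))
    (F₂.r0.trans (F₁.r0.trans hr)) w52 w62 r12).mono le_rfl ?_)
  rintro τ₃ ⟨F₃, s₃⟩
  have w53 : τ₃.w 5 = σ.w 5 := (F₃.w 5 (by decide) (by decide) (by decide) (by decide)).trans w52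
  have w63 : τ₃.w 6 = σ.w 6 := (F₃.w 6 (by decide) (by decide) (by decide) (by decide)).trans w62
  have r13 : τ₃.r 1 = σ.r 1 := (F₃.r 1 (by decide) (by decide) (by decide)).trans r12
  have w03 : τ₃.w 0 = σ₀.w 0 := F₃.w0.trans (F₂.w0.trans (F₁.w0.trans hw))
  have r03 : τ₃.r 0 = σ₀.r 0 := F₃.r0.trans (F₂.r0.trans (F₁.r0.trans hr))
  refine (run_attend (B := B') (σ := τ₃) (Q := rowwise (T.query l h) X)
    (K := rowwise (T.key l h) X) (V := rowwise (T.value l h) X) (Y := Y) (by rw [w03, I.N_eq])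
    (by rw [w03, I.m_eq]) ?_ ?_ s₃ ?_ hB.N_lt hB.m_lt hB.NN_lt hB.Nm_lt).mono le_rfl ?_
  · rwa [F₃.r 5 (by decide) (by decide) (by decide), F₂.r 5 (by decide) (by decide) (by decide)]
  · rwa [F₃.r 6 (by decide) (by decide) (by decide)]
  · rwa [F₃.r 3 (by decide) (by decide) (by decide), F₂.r 3 (by decide) (by decide) (by decide),
      F₁.r 3 (by decide) (by decide) (by decide)]
  · rintro τ ⟨hw', hr', hs⟩
    exact ⟨(hw' 0 (by decide) (by decide)).trans w03,
      (hr' 0 (by decide) (by decide) (by decide) (by decide)).trans r03,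
      (hw' 5 (by decide) (by decide)).trans w53, (hw' 6 (by decide) (by decide)).trans w63,
      (hr' 1 (by decide) (by decide) (by decide) (by decide)).trans r13, hs⟩

theorem layer_time_le {Z H : ℕ} {A D : ℕ} (hZ : 0 < Z) (hH : 0 < H) (hA : A ≤ 8 * Z)
    (hD : D ≤ 23 * Z) : A + (H * (102 * Z + 2) + 2 + D) ≤ 137 * (H * Z) := by
  have h1 : Z ≤ H * Z := Nat.le_mul_of_pos_left _ hH
  have h2 : H * (102 * Z + 2) ≤ H * (104 * Z) := Nat.mul_le_mul_left _ (by omega)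
  have e : H * (104 * Z) = 104 * (H * Z) := by ring
  omega

/-- Array `3` starts as a copy of `X`, the residual term, and accumulates the heads, while array `1`
keeps `X` for the heads still to come. Only the MLP writes back into array `1`. -/
theorem run_layer (I : Implements T N B S σ₀ pq pk pv pm po) (hBB : B ≤ B')
    (hB : SizesLT N L H m dout B') (hN : 0 < N) (hH : 0 < H) (hS : 0 < S) (hmS : m ≤ S)
    {σ : State} {X : Matrix (Fin N) (Fin m) ℝ} (l : Fin L)
    (hw : σ.w 0 = σ₀.w 0) (hr : σ.r 0 = σ₀.r 0) (hl : σ.w 5 0 = l) (hX : Stores (σ.r 1) X) :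
    Run B' (layerProg pq pk pv pm) σ (137 * (H * (N * N * S))) (fun τ =>
      τ.w 0 = σ₀.w 0 ∧ τ.r 0 = σ₀.r 0 ∧ τ.w 5 0 = l ∧ Stores (τ.r 1) (T.layer l X)) := by
  have hB0 : 0 < B' := (Nat.zero_le N).trans_lt hB.N_lt
  have hZ : 0 < N * N * S := by positivity
  have hA : N * m * (3 * 0 + 6) + 2 ≤ 8 * (N * N * S) := by
    have h1 : N * m ≤ N * N * S := Nat.mul_le_mul (Nat.le_mul_of_pos_left _ hN) hmS
    omega
  refine Run.mono ?_ (layer_time_le hZ hH hA (rows_time_le hN hS hmS hmS)) fun τ h => h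
  refine Run.seq ((Run.tabulate (B := B') (o := 0) (k₁ := N * m) (k₂ := 0) (fun _ _ => 0)
      (fun x => σ.r 1 x) (by decide) hB.Nm_lt hB0 (fun _ _ => rfl) (fun τ' h => ?_)
      (fun _ _ => rfl) (fun _ _ _ _ u hu => absurd hu (by omega)) ?_).mono le_rfl ?_)
  · simp [par, WExp.eval, h.w 0, hw, I.N_eq, I.m_eq]
  · intro τ h x hx h1 _ _
    simp [RExp.eval, xVar, WExp.eval, h1, h.r 1]
  rintro τ₁ ⟨F₁, G₁, -⟩
  -- The heads are extended by zero to all natural indices, so that the invariant can use partial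
  -- sums over `Finset.range k`.
  let A : ℕ → Matrix (Fin N) (Fin m) ℝ := fun x => if h : x < H then
    attentionHead (T.query l ⟨x, h⟩) (T.key l ⟨x, h⟩) (T.value l ⟨x, h⟩) X else 0
  refine Run.seq ((Run.forLoop (T := 102 * (N * N * S)) (k := H) (fun k τ => τ.w 6 0 = k ∧
    τ.w 0 = σ₀.w 0 ∧ τ.r 0 = σ₀.r 0 ∧ τ.w 5 0 = l ∧ Stores (τ.r 1) X ∧
      Stores (τ.r 3) (X + ∑ x ∈ Finset.range k, A x)) hB.H_lt ?_ ?_ ?_).mono le_rfl ?_)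
  · refine ⟨by simp, ?_, ?_, ?_, ?_, ?_⟩
    · rw [State.setW_w_ne _ _ _ (by decide), F₁.w 0 (by decide) (by decide), hw]
    · rw [State.setW_r, F₁.r 0 (by decide) (by decide), hr]
    · rw [State.setW_w_ne _ _ _ (by decide), F₁.w 5 (by decide) (by decide), hl]
    · rw [State.setW_r, F₁.r 1 (by decide) (by decide)]
      exact hX
    · intro i u
      have := G₁ _ (flat_lt i u)
      rw [zero_add] at this
      simpa using this.trans (hX i u)
  · rintro k - τ ⟨h6, h0, -⟩
    exact ⟨h6, by simp [par, WExp.eval, h0, I.H_eq]⟩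
  · rintro k hk τ ⟨h6, h0, hr0, h5, h1, h3⟩
    refine (run_head I hBB hB hN hS hmS l ⟨k, hk⟩ h0 hr0 h5 h6 h1 h3).mono le_rfl ?_
    rintro τ' ⟨w0, r0, w5, w6, r1, r3⟩
    refine ⟨by rw [w6, h6], by simp, ?_, ?_, ?_, ?_, ?_⟩
    · rw [State.setW_w_ne _ _ _ (by decide), w0]
    · rw [State.setW_r, r0]
    · rw [State.setW_w_ne _ _ _ (by decide), w5, h5]
    · rw [State.setW_r, r1]; exact h1
    · rw [State.setW_r, Finset.sum_range_succ, ← add_assoc]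
      simpa [A, hk] using r3
  rintro τ₂ ⟨-, h0, hr0, h5, h1, h3⟩
  have hsum : ∑ x ∈ Finset.range H, A x =
      ∑ h, attentionHead (T.query l h) (T.key l h) (T.value l h) X := by
    rw [Finset.sum_range]
    exact Finset.sum_congr rfl fun h _ => by simp [A]
  rw [hsum] at h3
  refine (run_applyRows hBB (i := fun _ => l) (j := fun _ => 0)
    (y := T.layer l X) (by decide) (by decide) (by decide) (by decide) (by decide) h0 hr0 I.N_eq
    (fun t => I.mlp l _) h3 hB.N_lt hB.m_lt hB.m_lt (fun _ _ => l.2.trans hB.L_lt)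
    (fun _ _ => hB0) ?_ ?_ ?_ ?_).mono le_rfl ?_
  · intro τ' _ h5' _
    simp [layerVar, WExp.eval, h5', h5]
  · intro τ' _ _ _
    rfl
  · intro τ' h0'
    simp [par, WExp.eval, h0', h0, I.m_eq]
  · intro τ' h0'
    simp [par, WExp.eval, h0', h0, I.m_eq]
  · rintro τ ⟨F, s⟩
    refine ⟨F.w0.trans h0, F.r0.trans hr0, ?_, s⟩
    rw [F.w 5 (by decide) (by decide) (by decide) (by decide), h5]

theorem eval_time_le {Z L H : ℕ} {D : ℕ} (hZ : 0 < Z) (hL : 0 < L) (hH : 0 < H)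
    (hD : D ≤ 23 * Z) : L * (137 * (H * Z) + 2) + 2 + D ≤ 164 * (L * (H * Z)) := by
  have h0 : Z ≤ H * Z := Nat.le_mul_of_pos_left _ hH
  have h1 : H * Z ≤ L * (H * Z) := Nat.le_mul_of_pos_left _ hL
  have h2 : L * (137 * (H * Z) + 2) ≤ L * (139 * (H * Z)) := Nat.mul_le_mul_left _ (by omega)
  have e : L * (139 * (H * Z)) = 139 * (L * (H * Z)) := by ring
  omega

theorem run_eval (I : Implements T N B S σ₀ pq pk pv pm po) (hBB : B ≤ B')
    (hB : SizesLT N L H m dout B') (hN : 0 < N) (hL : 0 < L) (hH : 0 < H) (hS : 0 < S)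
    (hmS : m ≤ S) (hdS : dout ≤ S) {σ : State} {X : Matrix (Fin N) (Fin m) ℝ}
    (hw : σ.w 0 = σ₀.w 0) (hr : σ.r 0 = σ₀.r 0) (hX : Stores (σ.r 1) X) :
    Run B' (evalProg pq pk pv pm po) σ (164 * (L * (H * (N * N * S)))) (fun τ =>
      τ.w 0 = σ₀.w 0 ∧ Stores (τ.r 2) (T.eval X)) := by
  have hB0 : 0 < B' := (Nat.zero_le N).trans_lt hB.N_lt
  have hZ : 0 < N * N * S := by positivity
  refine Run.mono ?_ (eval_time_le hZ hL hH (rows_time_le hN hS hmS hdS)) fun τ h => h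
  refine Run.seq ((Run.forLoop (T := 137 * (H * (N * N * S))) (k := L) (fun k τ => τ.w 5 0 = k ∧
    τ.w 0 = σ₀.w 0 ∧ τ.r 0 = σ₀.r 0 ∧ ∀ hk : k ≤ L, Stores (τ.r 1) (T.hidden X k hk))
    hB.L_lt ?_ ?_ ?_).mono le_rfl ?_)
  · exact ⟨by simp, by rw [State.setW_w_ne _ _ _ (by decide), hw], by rw [State.setW_r, hr],
      fun _ => hX⟩
  · rintro k - τ ⟨h5, h0, -⟩
    exact ⟨h5, by simp [par, WExp.eval, h0, I.L_eq]⟩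
  · rintro k hk τ ⟨h5, h0, hr0, h1⟩
    refine (run_layer I hBB hB hN hH hS hmS ⟨k, hk⟩ h0 hr0 h5 (h1 hk.le)).mono le_rfl ?_
    rintro τ' ⟨w0, r0, w5, r1⟩
    exact ⟨w5, by simp, by rw [State.setW_w_ne _ _ _ (by decide), w0], by rw [State.setW_r, r0],
      fun _ => r1⟩
  rintro τ₁ ⟨-, h0, hr0, h1⟩
  refine (run_applyRows hBB (i := fun _ => 0) (j := fun _ => 0) (y := T.eval X)
    (by decide) (by decide) (by decide) (by decide) (by decide) h0 hr0 I.N_eq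
    (fun t => I.out _) (h1 le_rfl) hB.N_lt hB.m_lt hB.dout_lt (fun _ _ => hB0) (fun _ _ => hB0)
    (fun _ _ _ _ => rfl) (fun _ _ _ _ => rfl) ?_ ?_).mono le_rfl ?_
  · intro τ' h0'
    simp [par, WExp.eval, h0', h0, I.m_eq]
  · intro τ' h0'
    simp [par, WExp.eval, h0', h0, I.dout_eq]
  · rintro τ ⟨F, s⟩
    exact ⟨F.w0.trans h0, s⟩

end

end RealRAM

/-! ### Word sizes, time budget and input memory -/

namespace RealRAM

open TransformerFamily

theorem _root_.TransformerFamily.Evaluates.mono {B p σ₀ i j a b S S'} {x : Fin a → ℝ} {y : Fin b → ℝ}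
    (h : Evaluates B p σ₀ i j x y S) (hS : S ≤ S') : Evaluates B p σ₀ i j x y S' := by
  intro σ h1 h2 h3 h4 h5
  obtain ⟨σ', t, e, ht, h⟩ := h σ h1 h2 h3 h4 h5
  exact ⟨σ', t, e, ht.trans hS, h⟩

/-- A subroutine has to write all components of its value. -/
theorem _root_.TransformerFamily.Evaluates.length_le {B p σ₀ i j a b S} {x : Fin a → ℝ} {y : Fin b → ℝ}
    (h : Evaluates B p σ₀ i j x y S) : b ≤ S := by
  obtain ⟨σ', t, e, ht, -, -, hy⟩ := h
    -- The output array starts with `y u + 1` in cell `u`, so every output cell has to change, and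
    -- each change costs a step.
    ⟨fun k c => if k = 1 then (if c = 0 then i else j) else σ₀.w k c,
      fun k c => if k = 2 then (if hc : c < b then y ⟨c, hc⟩ + 1 else 0) else
        if k = 1 then (if hc : c < a then x ⟨c, hc⟩ else 0) else σ₀.r k c⟩
    (by simp) (by simp) (by simp) (by simp) (by simp)
  obtain ⟨s, hs, hc⟩ := e.exists_changed
  have hmem : ∀ u : Fin b, (2, u.val) ∈ s := fun u => by
    by_contra hu
    have := hc 2 u hu
    rw [hy u] at this
    simp at this
  calc b = (Finset.univ.image fun u : Fin b => (2, u.val)).card := by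
        rw [Finset.card_image_of_injective _ fun u v h => by simpa [Fin.ext_iff] using h]; simp
    _ ≤ s.card := Finset.card_le_card fun z hz => by
        obtain ⟨u, -, rfl⟩ := Finset.mem_image.1 hz
        exact hmem u
    _ ≤ S := hs.trans ht

theorem ovDim_le (c n : ℕ) : ovDim c n ≤ c * (Nat.log 2 n + 1) :=
  Nat.mul_le_mul_left _ (Nat.clog_le_of_le_pow (Nat.lt_pow_succ_log_self (by norm_num) n).le)

theorem ovDim_lt (c n : ℕ) : ovDim c n < (n + 2) ^ (c + 1) := by
  have h1 : Nat.clog 2 n ≤ n := Nat.clog_le_of_le_pow Nat.lt_two_pow_self.le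
  have h2 : c < (n + 2) ^ c := Nat.lt_pow_self (by omega)
  calc ovDim c n ≤ c * (n + 2) := Nat.mul_le_mul_left _ (by omega)
    _ < (n + 2) ^ c * (n + 2) := Nat.mul_lt_mul_of_pos_right h2 (by omega)
    _ = (n + 2) ^ (c + 1) := (pow_succ _ _).symm

/-- What the set-up program provides for the calling program, for a fixed `n`. -/
structure Ready {c : ℕ} (F : TransformerFamily c) (setup pe pq pk pv pm po : Prog) (κ D n : ℕ)
    (σ₀ : State) (B S t₀ : ℕ) : Prop where
  B_le : B ≤ wordBound κ n
  exec : Exec B setup (initState n (ovDim c n)) σ₀ t₀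
  n_eq : σ₀.w 0 0 = n
  d_eq : σ₀.w 0 1 = ovDim c n
  impl : Implements (F.T n) (F.N n) B S σ₀ pq pk pv pm po
  emb : ∀ (t : Fin (F.N n)) (v : Fin 3 → Fin (ovDim c n) → Bool),
    Evaluates B pe σ₀ t 0 (tokenBits v) (F.emb n t v) S
  sizes : SizesLT (F.N n) (F.L n) (F.H n) (F.m n) (F.dout n) (wordBound κ n)
  d_lt : 3 * ovDim c n < wordBound κ n
  Nd_lt : F.N n * (3 * ovDim c n) < wordBound κ n
  one_lt : 1 < wordBound κ n
  S_pos : 0 < S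
  m_le : F.m n ≤ S
  dout_le : F.dout n ≤ S
  d_le : 3 * ovDim c n ≤ S
  time_le : t₀ + 197 * (F.L n * (F.H n * (F.N n * F.N n * S))) ≤ F.evalTime D n

/-- Everything the caller needs is bounded in terms of quantities under control: the sizes because
the set-up leaves them in words, and `dout` by `S` because a subroutine must have time to write its
output. -/
theorem exists_ready {c : ℕ} {F : TransformerFamily c} (hF : F.LinearTimeMaps) :
    ∃ (setup pe pq pk pv pm po : Prog) (κ D : ℕ), ∀ n, 0 < n →
      ∃ σ₀ B S t₀, Ready F setup pe pq pk pv pm po κ D n σ₀ B S t₀ := by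
  obtain ⟨setup, pe, pq, pk, pv, pm, po, κ, C, h⟩ := hF
  -- Sizes lie below `b = (n + 2) ^ (κ + c + 1)` and their products below `b * b`; the remaining `(n
  -- + 2) ^ 2 ≥ 4` absorbs the factor `3` in the number of token bits. The factor `198` is `197` for
  -- the caller plus `1` for the set-up.
  refine ⟨setup, pe, pq, pk, pv, pm, po, 2 * (κ + c + 1) + 2, 198 * (C + 3 * c + 1),
    fun n hn => ?_⟩
  obtain ⟨σ₀, t₀, hex, ht₀, hn0, hd0, hN0, hL0, hH0, hm0, hdo0, hemb, hqkv, hmlp, hout⟩ := h n hn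
  -- `C` covers the given time bounds, `3 * c` the number of bits of a token, and `1` makes `D`
  -- positive.
  obtain ⟨D, hD⟩ : ∃ D, D = C + 3 * c + 1 := ⟨_, rfl⟩
  obtain ⟨ℓ, hℓ⟩ : ∃ ℓ, ℓ = Nat.log 2 n + 1 := ⟨_, rfl⟩
  have hℓ0 : 0 < ℓ := by omega
  obtain ⟨S, hS⟩ : ∃ S, S = D * F.m n * ℓ ^ D := ⟨_, rfl⟩
  have hpow : 0 < ℓ ^ D := Nat.pow_pos hℓ0
  have hCS : C * F.m n * (Nat.log 2 n + 1) ^ C ≤ S := by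
    rw [hS, ← hℓ]
    exact Nat.mul_le_mul (Nat.mul_le_mul_right _ (by omega)) (Nat.pow_le_pow_right hℓ0 (by omega))
  have hmS : F.m n ≤ S := by
    rw [hS]
    exact (Nat.le_mul_of_pos_left _ (by omega)).trans (Nat.le_mul_of_pos_right _ hpow)
  have hdS : 3 * ovDim c n ≤ S := by
    have h1 := ovDim_le c n
    rw [← hℓ] at h1
    calc 3 * ovDim c n ≤ 3 * (c * ℓ) := Nat.mul_le_mul_left _ h1
      _ = (3 * c) * ℓ := by ring
      _ ≤ (D * F.m n) * ℓ ^ D := Nat.mul_le_mul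
          ((by omega : 3 * c ≤ D).trans (Nat.le_mul_of_pos_right _ (F.m_pos n)))
          (Nat.le_self_pow (by omega) _)
      _ = S := hS.symm
  -- The exponent is raised from `κ` because `n` and `d`, present from the start, need not be below
  -- the given word bound.
  have hw : ∀ i, σ₀.w 0 i < (n + 2) ^ (κ + c + 1) := by
    have hB : wordBound κ n ≤ (n + 2) ^ (κ + c + 1) := Nat.pow_le_pow_right (by omega) (by omega)
    refine (hex.mono hB).words_lt (fun a i => ?_) 0
    have h1 : n < (n + 2) ^ (κ + c + 1) := by
      have := Nat.le_self_pow (show κ + c + 1 ≠ 0 by omega) (n + 2)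
      omega
    have h2 : ovDim c n < (n + 2) ^ (κ + c + 1) :=
      (ovDim_lt c n).trans_le (Nat.pow_le_pow_right (by omega) (by omega))
    simp only [initState]
    split_ifs <;> omega
  obtain ⟨b, hbdef⟩ : ∃ b, b = (n + 2) ^ (κ + c + 1) := ⟨_, rfl⟩
  rw [← hbdef] at hw
  have hbig : wordBound (2 * (κ + c + 1) + 2) n = b * b * (n + 2) ^ 2 := by
    rw [wordBound, hbdef]; ring
  have hN := hw 2; have hL := hw 3; have hH := hw 4; have hm := hw 5; have hdo := hw 6
  have hd := hw 1
  rw [hN0] at hN; rw [hL0] at hL; rw [hH0] at hH; rw [hm0] at hm; rw [hdo0] at hdo; rw [hd0] at hd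
  have hb0 : 0 < b := by omega
  have h4 : 4 ≤ (n + 2) ^ 2 := by nlinarith
  have hbb : b * b * 4 ≤ b * b * (n + 2) ^ 2 := Nat.mul_le_mul_left _ h4
  have hb1 : b ≤ b * b := Nat.le_mul_of_pos_left _ hb0
  have hNN : F.N n * F.N n < b * b := Nat.mul_lt_mul'' hN hN
  have hNm : F.N n * F.m n < b * b := Nat.mul_lt_mul'' hN hm
  have hNd : F.N n * ovDim c n < b * b := Nat.mul_lt_mul'' hN hd
  have hdoS : F.dout n ≤ S := (Evaluates.length_le (hout 0)).trans hCS
  refine ⟨σ₀, wordBound κ n, S, t₀, ?_, hex, hn0, hd0, ?_, fun t v => (hemb t v).mono hCS, ?_,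
    ?_, ?_, ?_, (F.m_pos n).trans_le hmS, hmS, hdoS, hdS, ?_⟩
  · exact Nat.pow_le_pow_right (by omega) (by omega)
  · exact ⟨hN0, hL0, hH0, hm0, hdo0, fun l h x => ((hqkv l h x).1).mono hCS,
      fun l h x => ((hqkv l h x).2.1).mono hCS, fun l h x => ((hqkv l h x).2.2).mono hCS,
      fun l x => (hmlp l x).mono hCS, fun x => (hout x).mono hCS⟩
  · rw [hbig]
    constructor <;> omega
  · rw [hbig]; omega
  · rw [hbig, mul_left_comm]; omega
  · rw [hbig]; omega
  · rw [evalTime] at ht₀ ⊢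
    rw [← hℓ] at ht₀ ⊢
    rw [← hD]
    obtain ⟨X, hX⟩ : ∃ X, X = F.N n ^ 2 * F.m n * F.H n * F.L n := ⟨_, rfl⟩
    rw [← hX] at ht₀ ⊢
    have e : F.L n * (F.H n * (F.N n * F.N n * S)) = D * X * ℓ ^ D := by rw [hS, hX]; ring
    have h1 : C * X * ℓ ^ C ≤ D * X * ℓ ^ D :=
      Nat.mul_le_mul (Nat.mul_le_mul_right _ (by omega)) (Nat.pow_le_pow_right hℓ0 (by omega))
    have h2 : 198 * D * X * ℓ ^ D ≤ 198 * D * X * ℓ ^ (198 * D) :=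
      Nat.mul_le_mul_left _ (Nat.pow_le_pow_right hℓ0 (by omega))
    have e2 : 198 * D * X * ℓ ^ D = 198 * (D * X * ℓ ^ D) := by ring
    rw [e]
    omega

theorem run_setup {B B' n d t₀ : ℕ} (hBB : B ≤ B') {setup : Prog} {σ₀ σ : State}
    (h : Exec B setup (initState n d) σ₀ t₀) (hσ : σ.pull (4 * ·) = initState n d) :
    Run B' setup.embedded σ t₀ (fun τ => τ.w 0 = σ₀.w 0 ∧ τ.r 0 = σ₀.r 0 ∧
      (∀ a, ¬ 4 ∣ a → τ.w a = σ.w a) ∧ ∀ a, ¬ 4 ∣ a → τ.r a = σ.r a) := by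
  obtain ⟨τ, e, rfl, hw, hr⟩ := h.rename quad_injective σ hσ
  exact ⟨τ, t₀, e.mono hBB, le_rfl, rfl, rfl, fun a ha => hw a (notMem_range_quad ha),
    fun a ha => hr a (notMem_range_quad ha)⟩

theorem pull_evalInput (d n : ℕ) {N m : ℕ} (X : Matrix (Fin N) (Fin m) ℝ) :
    (evalInput d n X).pull (4 * ·) = initState n d := by
  ext a i
  · simp [State.pull, evalInput, initState]
  · simp [State.pull, evalInput, initState]

/-- The bits are in word arrays `1`, `2`, `3`, none of them a multiple of `4`, so the renamed set-up
sees only `n` and `d` in otherwise zero memory, as it expects. -/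
theorem pull_ovInput {n d : ℕ} (A : OVInstance n d) :
    (ovInput A).pull (4 * ·) = initState n d := by
  ext a i
  · rcases Nat.eq_zero_or_pos a with rfl | ha
    · simp [State.pull, ovInput]
    · have h1 : ¬ 4 * a - 1 < 3 := by omega
      simp [State.pull, ovInput, initState, h1, ha.ne']
  · simp [State.pull, ovInput, initState]

theorem stores_evalInput (d n : ℕ) {N m : ℕ} (X : Matrix (Fin N) (Fin m) ℝ) :
    Stores ((evalInput d n X).r 1) X := by
  intro i u
  have h := flat_lt i u
  have hi : (⟨i * m + u, h⟩ : Fin (N * m)).divNat = i := Fin.ext (flat_div _ _)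
  have hu : (⟨i * m + u, h⟩ : Fin (N * m)).modNat = u := Fin.ext (flat_mod _ _)
  simp only [evalInput, h, and_self, dite_true, hi, hu]

theorem ovInput_w {n d : ℕ} (A : OVInstance n d) (k : Fin 3) (i : Fin n) (j : Fin d) :
    (ovInput A).w (k + 1) (i * d + j) = if A k i j = true then 1 else 0 := by
  have h := flat_lt i j
  have hi : (⟨i * d + j, h⟩ : Fin (n * d)).divNat = i := Fin.ext (flat_div _ _)
  have hu : (⟨i * d + j, h⟩ : Fin (n * d)).modNat = j := Fin.ext (flat_mod _ _)
  simp only [ovInput, Nat.add_sub_cancel, h, k.2, and_self, dite_true, hi, hu, Nat.add_one_ne_zero,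
    if_false]

theorem _root_.TransformerFamily.evaluableInStandardTime {c : ℕ} {F : TransformerFamily c}
    (hF : F.LinearTimeMaps) : F.EvaluableInStandardTime := by
  obtain ⟨setup, pe, pq, pk, pv, pm, po, κ, D, h⟩ := exists_ready hF
  refine ⟨.seq setup.embedded (evalProg pq pk pv pm po), κ, D, fun n hn X => ?_⟩
  obtain ⟨σ₀, B, S, t₀, R⟩ := h n hn
  have hN : 0 < F.N n := hn.trans_le (F.le_N n)
  have := Run.seq ((run_setup R.B_le R.exec (pull_evalInput (ovDim c n) n X)).mono le_rfl
    fun τ hτ => (run_eval R.impl R.B_le R.sizes hN (F.L_pos n) (F.H_pos n) R.S_pos R.m_le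
      R.dout_le hτ.1 hτ.2.1 (by rw [hτ.2.2.2 1 (by decide)]; exact stores_evalInput _ _ X)))
  obtain ⟨σ, t, e, ht, -, hs⟩ := this
  have := R.time_le
  exact ⟨σ, t, e, by omega, hs⟩

/-! ### Deciding 3-OV with a transformer -/

/-- The bit number `x` of the token encodings. -/
def bitExp : WExp :=
  let d := par 1
  let cell := WExp.add (.mul ((WExp.div xVar (.mul (.const 3) d)).mod (par 0)) d)
    ((xVar.mod (.mul (.const 3) d)).mod d)
  let k := WExp.div (xVar.mod (.mul (.const 3) d)) d
  .add (.add (.mul (.get 1 cell) (.sub (.const 1) k))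
    (.mul (.get 2 cell) (.mul k (.sub (.const 2) k)))) (.mul (.get 3 cell) (.sub k (.const 1)))

/-- Write the token encodings into real array `1`. -/
def embedProg (pe : Prog) : Prog :=
  .seq (tabulate 3 (.const 0) (.mul (par 2) (.mul (.const 3) (par 1))) (.const 0) (.cast (.const 0))
    (.cast bitExp))
  (applyRows pe 3 1 rowVar (.const 0) (.mul (.const 3) (par 1)) (par 5))

def ovProg (setup pe pq pk pv pm po : Prog) : Prog :=
  .seq setup.embedded (.seq (embedProg pe) (.seq (evalProg pq pk pv pm po)
    (.ite (.rlt (.cast (.const 0)) (.get 2 (.const 0)))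
      (.wset 0 (.const 0) (.const 1)) (.wset 0 (.const 0) (.const 0)))))

/-- With truncated subtraction the three factors are the indicators of `k = 0, 1, 2`. Array names
are fixed in the program, so a list can be selected only by arithmetic of this kind. -/
theorem select_array (k : Fin 3) (f : ℕ → ℕ) :
    f 1 * (1 - k) + f 2 * (k * (2 - k)) + f 3 * (k - 1) = f (k + 1) := by
  fin_cases k <;> simp

theorem run_embed {c : ℕ} {F : TransformerFamily c} {setup pe pq pk pv pm po : Prog}
    {κ D n : ℕ} {σ₀ : State} {B S t₀ : ℕ} (R : Ready F setup pe pq pk pv pm po κ D n σ₀ B S t₀)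
    (hn : 0 < n) (A : OVInstance n (ovDim c n)) {σ : State} (hw : σ.w 0 = σ₀.w 0)
    (hr : σ.r 0 = σ₀.r 0) (hA : ∀ a, ¬ 4 ∣ a → σ.w a = (ovInput A).w a) :
    Run (wordBound κ n) (embedProg pe) σ (31 * (F.N n * F.N n * S)) (fun τ =>
      τ.w 0 = σ₀.w 0 ∧ τ.r 0 = σ₀.r 0 ∧ Stores (τ.r 1) (F.input hn A)) := by
  have hN : 0 < F.N n := hn.trans_le (F.le_N n)
  have hZ : 0 < F.N n * F.N n * S := Nat.mul_pos (Nat.mul_pos hN hN) R.S_pos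
  have hA' : F.N n * (3 * ovDim c n) * (3 * 0 + 6) + 2 ≤ 8 * (F.N n * F.N n * S) := by
    have h1 : F.N n * (3 * ovDim c n) ≤ F.N n * F.N n * S :=
      Nat.mul_le_mul (Nat.le_mul_of_pos_left _ hN) R.d_le
    omega
  have hrows := rows_time_le hN R.S_pos R.d_le R.m_le
  refine Run.mono (T := (F.N n * (3 * ovDim c n) * (3 * 0 + 6) + 2) +
    (F.N n * (6 * (3 * ovDim c n) + 6 * F.m n + S + 8) + 2)) ?_ (by omega) fun τ h => h
  refine Run.seq ((Run.tabulate (o := 0) (k₁ := F.N n * (3 * ovDim c n)) (k₂ := 0)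
    (fun _ _ => 0) (fun x => (((ovInput A).w (x % (3 * ovDim c n) / ovDim c n + 1)
      (x / (3 * ovDim c n) % n * ovDim c n + x % (3 * ovDim c n) % ovDim c n) : ℕ) : ℝ))
    (by decide) R.Nd_lt (by have := R.one_lt; omega) (fun _ _ => rfl) (fun τ h => ?_)
    (fun _ _ => rfl) (fun _ _ _ _ u hu => absurd hu (by omega)) ?_).mono le_rfl ?_)
  · simp [par, WExp.eval, h.w 0, hw, R.impl.N_eq, R.d_eq]
  · intro τ h x hx h1 _ _
    have hlt : x % (3 * ovDim c n) / ovDim c n < 3 := by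
      -- The dimension can be `0`, for instance when `n = 1`; then the table is empty and there is
      -- no `x` to treat.
      have hpos : 0 < 3 * ovDim c n := Nat.pos_of_ne_zero fun h0 => by simp [h0] at hx
      exact Nat.div_lt_of_lt_mul ((Nat.mod_lt _ hpos).trans_eq (mul_comm _ _))
    have key := select_array ⟨_, hlt⟩ fun a => (ovInput A).w a
      (x / (3 * ovDim c n) % n * ovDim c n + x % (3 * ovDim c n) % ovDim c n)
    rw [← key]
    simp [RExp.eval, bitExp, par, xVar, WExp.eval, WExp.eval_mod, h1, h.w 0, h.w 1, h.w 2, h.w 3,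
      hw, R.n_eq, R.d_eq, hA 1, hA 2, hA 3]
  rintro τ₁ ⟨F₁, G₁, -⟩
  have h0 : τ₁.w 0 = σ₀.w 0 := (F₁.w 0 (by decide) (by decide)).trans hw
  refine (run_applyRows R.B_le (i := fun t => t) (j := fun _ => 0) (y := F.input hn A)
    (x := Matrix.of fun t : Fin (F.N n) => tokenBits fun k => A k ⟨t % n, Nat.mod_lt _ hn⟩)
    (by decide) (by decide) (by decide) (by decide) (by decide) h0
    ((F₁.r 0 (by decide) (by decide)).trans hr) R.impl.N_eq (fun t => R.emb t fun k => A k ⟨t % n, Nat.mod_lt _ hn⟩) ?_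
    R.sizes.N_lt R.d_lt R.sizes.m_lt (fun t ht => ht.trans R.sizes.N_lt)
    (fun _ _ => by have := R.one_lt; omega) (fun _ _ _ _ => rfl) (fun _ _ _ _ => rfl)
    ?_ ?_).mono le_rfl ?_
  · intro t u
    have := G₁ _ (flat_lt t u)
    rw [zero_add, flat_div, flat_mod] at this
    rw [this]
    have h2 := ovInput_w A u.divNat ⟨t % n, Nat.mod_lt _ hn⟩ u.modNat
    simp only [Fin.coe_divNat, Fin.coe_modNat] at h2
    rw [h2]
    simp [tokenBits]
  · intro τ' h'
    simp [par, WExp.eval, h', h0, R.d_eq]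
  · intro τ' h'
    simp [par, WExp.eval, h', h0, R.impl.m_eq]
  · rintro τ ⟨G, s⟩
    exact ⟨G.w0.trans h0, G.r0.trans ((F₁.r 0 (by decide) (by decide)).trans hr), s⟩

/-- Set-up, encoding of the tokens, evaluation and one sign test. The costs after the set-up are `31
+ 164 + 2 = 197` units, the constant in `Ready.time_le`. -/
theorem _root_.TransformerFamily.exists_solvesThreeOV {c : ℕ} {F : TransformerFamily c}
    (hF : F.LinearTimeMaps) (hOV : F.ComputesThreeOV) :
    ∃ (p : Prog) (κ D : ℕ), SolvesThreeOV c p κ (F.evalTime D) := by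
  obtain ⟨setup, pe, pq, pk, pv, pm, po, κ, D, h⟩ := exists_ready hF
  refine ⟨ovProg setup pe pq pk pv pm po, κ, D, fun n hn A hA => ?_⟩
  obtain ⟨σ₀, B, S, t₀, R⟩ := h n hn
  have hN : 0 < F.N n := hn.trans_le (F.le_N n)
  have hcorrect := hOV n hn A hA
  have : Run (wordBound κ n) (ovProg setup pe pq pk pv pm po) (ovInput A)
      (t₀ + (31 * (F.N n * F.N n * S) + (164 * (F.L n * (F.H n * (F.N n * F.N n * S))) + 2)))
      (fun σ => (HasOrthogonalTriple A → σ.w 0 0 = 1) ∧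
        (¬ HasOrthogonalTriple A → σ.w 0 0 = 0)) := by
    refine Run.seq ((run_setup R.B_le R.exec (pull_ovInput A)).mono le_rfl
      fun τ hτ => Run.seq ((run_embed R hn A hτ.1 hτ.2.1 hτ.2.2.1).mono le_rfl
      fun τ' hτ' => Run.seq ((run_eval R.impl R.B_le R.sizes hN (F.L_pos n) (F.H_pos n) R.S_pos
        R.m_le R.dout_le hτ'.1 hτ'.2.1 hτ'.2.2).mono le_rfl ?_)))
    rintro τ₁ ⟨-, hs⟩
    -- The first output coordinate of the first token is in cell `0`, whatever `dout` is.
    have h0 := hs ⟨0, hN⟩ ⟨0, F.dout_pos n⟩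
    simp only [zero_mul, add_zero] at h0
    rw [← h0] at hcorrect
    by_cases hpos : 0 < τ₁.r 2 0
    · refine ⟨_, _, .ite_true (by simpa [Test.Holds, RExp.eval, WExp.eval] using hpos)
        (.wset _ _ _ _ (by simpa [WExp.eval] using R.one_lt)), le_rfl, fun _ => ?_,
        fun h => absurd (hcorrect.1 hpos) h⟩
      simp [WExp.eval]
    · refine ⟨_, _, .ite_false (by simpa [Test.Holds, RExp.eval, WExp.eval] using hpos)
        (.wset _ _ _ _ (Nat.zero_lt_one.trans R.one_lt)), le_rfl,
        fun h => absurd (hcorrect.2 h) hpos, fun _ => ?_⟩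
      simp [WExp.eval]
  obtain ⟨σ, t, e, ht, hσ⟩ := this
  refine ⟨σ, t, e, ht.trans ?_, hσ⟩
  have h1 := R.time_le
  have hZ : 0 < F.N n * F.N n * S := Nat.mul_pos (Nat.mul_pos hN hN) R.S_pos
  have h2 : F.N n * F.N n * S ≤ F.H n * (F.N n * F.N n * S) := Nat.le_mul_of_pos_left _ (F.H_pos n)
  have h3 := Nat.le_mul_of_pos_left (F.H n * (F.N n * F.N n * S)) (F.L_pos n)
  omega

end RealRAM

/-! ### Asymptotics -/

/-- The integer logarithm is `O(log n)`, and every power of `log n` is negligible against every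
positive power of `n`. -/
theorem natLog_add_one_pow_isLittleO (D : ℕ) {δ : ℝ} (hδ : 0 < δ) :
    (fun n : ℕ => ((Nat.log 2 n + 1 : ℕ) : ℝ) ^ D) =o[atTop] fun n : ℕ => (n : ℝ) ^ δ := by
  have h1 : (fun n : ℕ => ((Nat.log 2 n + 1 : ℕ) : ℝ)) =O[atTop] fun n : ℕ => Real.log n := by
    -- For `n ≥ 3 > e` the summand `1` is at most `log n`, and `1 / log 2 < 2`.
    refine IsBigO.of_bound 3 ?_
    filter_upwards [eventually_ge_atTop 3] with n hn
    have hn' : (3 : ℝ) ≤ n := by exact_mod_cast hn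
    have hlog : 1 ≤ Real.log n := by
      rw [Real.le_log_iff_exp_le (by linarith)]
      exact (Real.exp_one_lt_d9.le.trans (by norm_num)).trans hn'
    have h2 : (Nat.log 2 n : ℝ) ≤ Real.log n / Real.log 2 := by
      have := Real.natLog_le_logb n 2
      rwa [Real.logb, Nat.cast_ofNat] at this
    have h3 : Real.log n / Real.log 2 ≤ 2 * Real.log n := by
      rw [div_le_iff₀ (Real.log_pos (by norm_num))]
      nlinarith [Real.log_two_gt_d9]
    rw [Real.norm_of_nonneg (by positivity), Real.norm_of_nonneg (by linarith)]
    push_cast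
    linarith
  have h4 := (isLittleO_log_rpow_rpow_atTop (D : ℝ) hδ).comp_tendsto tendsto_natCast_atTop_atTop
  simp only [Function.comp_def, Real.rpow_natCast] at h4
  exact (h1.pow D).trans_isLittleO h4

/-! ### Running time in terms of the size of the transformers -/

namespace TransformerFamily

variable {c : ℕ} (F : TransformerFamily c)

/-- The exponent will be `3 - ε`, which is negative for large `ε`. The upper bound on `N` serves
nonnegative exponents, and `n ≤ N` the others. -/
theorem exists_N_rpow_le (s : ℝ) :
    ∃ M : ℝ, 0 ≤ M ∧ ∀ n : ℕ, 0 < n → (F.N n : ℝ) ^ s ≤ M * (n : ℝ) ^ s := by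
  obtain ⟨C, hC⟩ := F.N_le
  rcases le_total 0 s with hs | hs
  · refine ⟨(C : ℝ) ^ s, by positivity, fun n hn => ?_⟩
    rw [← Real.mul_rpow (by positivity) (by positivity)]
    exact Real.rpow_le_rpow (by positivity) (by exact_mod_cast hC n hn) hs
  · refine ⟨1, zero_le_one, fun n hn => ?_⟩
    rw [one_mul]
    exact Real.rpow_le_rpow_of_nonpos (by exact_mod_cast hn) (by exact_mod_cast F.le_N n) hs

/-- The time is `N² · size` up to logarithms, so the exponents add up to `2 + (1 - ε)`. The bound
holds for each single `n`, with `M` independent of `n` and `K`: it serves an asymptotic bound on the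
size as well as a bound at one `n`. -/
theorem exists_evalTime_le (D : ℕ) (ε : ℝ) :
    ∃ M : ℝ, 0 ≤ M ∧ ∀ (n : ℕ) (K : ℝ), 0 < n → 0 ≤ K →
      (F.size n : ℝ) ≤ K * (F.N n : ℝ) ^ (1 - ε) →
      (F.evalTime D n : ℝ) ≤ K * M * ((n : ℝ) ^ (3 - ε) * ((Nat.log 2 n + 1 : ℕ) : ℝ) ^ D) := by
  obtain ⟨M, hM, h⟩ := F.exists_N_rpow_le (3 - ε)
  refine ⟨D * M, by positivity, fun n K hn hK hsize => ?_⟩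
  have hN : (0 : ℝ) < F.N n := by exact_mod_cast hn.trans_le (F.le_N n)
  have e1 : (F.N n : ℝ) ^ 2 * (F.N n : ℝ) ^ (1 - ε) = (F.N n : ℝ) ^ (3 - ε) := by
    rw [← Real.rpow_natCast, ← Real.rpow_add hN]
    congr 1
    push_cast
    ring
  have e2 : F.evalTime D n = D * (F.N n ^ 2 * F.size n) * (Nat.log 2 n + 1) ^ D := by
    rw [evalTime, size]; ring
  rw [e2]
  push_cast
  calc (D : ℝ) * ((F.N n : ℝ) ^ 2 * F.size n) * ((Nat.log 2 n : ℝ) + 1) ^ D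
      ≤ D * ((F.N n : ℝ) ^ 2 * (K * (F.N n : ℝ) ^ (1 - ε))) * ((Nat.log 2 n : ℝ) + 1) ^ D := by
        gcongr
    _ = D * (K * (F.N n : ℝ) ^ (3 - ε)) * ((Nat.log 2 n : ℝ) + 1) ^ D := by
        rw [← e1]; ring
    _ ≤ D * (K * (M * (n : ℝ) ^ (3 - ε))) * ((Nat.log 2 n : ℝ) + 1) ^ D := by
        gcongr
        exact h n hn
    _ = _ := by ring

end TransformerFamily

/-! ### Evaluation in standard time and the two lower bounds -/

theorem mainTheorem7 :
    (∀ (c : ℕ) (F : TransformerFamily c), F.LinearTimeMaps → F.EvaluableInStandardTime) ∧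
    (ThreeOVHypothesis → ∀ ε : ℝ, 0 < ε → ∃ c : ℕ, ∀ F : TransformerFamily c,
      F.LinearTimeMaps → F.ComputesThreeOV →
        ¬ (fun n : ℕ => (F.size n : ℝ)) =O[atTop] (fun n : ℕ => (F.N n : ℝ) ^ (1 - ε))) ∧
    (ThreeOVHypothesisAE → ∀ ε : ℝ, 0 < ε → ∃ c : ℕ, ∀ F : TransformerFamily c,
      F.LinearTimeMaps → F.ComputesThreeOV →
        ∀ᶠ n : ℕ in atTop, (F.N n : ℝ) ^ (1 - ε) ≤ (F.size n : ℝ)) := by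
  have split : ∀ (ε : ℝ) (n : ℕ), 0 < n →
      (n : ℝ) ^ (3 - ε / 2) = (n : ℝ) ^ (3 - ε) * (n : ℝ) ^ (ε / 2) := fun ε n hn => by
    rw [← Real.rpow_add (by exact_mod_cast hn)]
    congr 1
    ring
  refine ⟨fun c F => TransformerFamily.evaluableInStandardTime, fun hyp ε hε => ?_,
    fun hyp ε hε => ?_⟩
  -- One half of `ε` is the gain over cubic time; the other half pays for the logarithmic factors.
  · obtain ⟨c, hc⟩ := hyp (ε / 2) (half_pos hε)
    refine ⟨c, fun F hF hOV hsize => ?_⟩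
    obtain ⟨p, κ, D, hp⟩ := TransformerFamily.exists_solvesThreeOV hF hOV
    refine hc p κ _ hp ?_
    obtain ⟨K, hK, hsize⟩ := hsize.exists_pos
    obtain ⟨M, hM, hM'⟩ := F.exists_evalTime_le D ε
    refine IsBigO.of_bound (K * M) ?_
    filter_upwards [hsize.bound, eventually_gt_atTop 0,
      (natLog_add_one_pow_isLittleO D (half_pos hε)).bound one_pos] with n h1 hn h2
    rw [Real.norm_of_nonneg (by positivity), Real.norm_of_nonneg (by positivity)] at h1 h2
    rw [Real.norm_of_nonneg (by positivity), Real.norm_of_nonneg (by positivity), split ε n hn]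
    refine (hM' n K hn hK.le h1).trans ?_
    rw [one_mul] at h2
    gcongr
  · obtain ⟨c, hc⟩ := hyp (ε / 2) (half_pos hε)
    refine ⟨c, fun F hF hOV => ?_⟩
    obtain ⟨p, κ, D, hp⟩ := TransformerFamily.exists_solvesThreeOV hF hOV
    obtain ⟨M, hM, hM'⟩ := F.exists_evalTime_le D ε
    -- The constant `(M + 1)⁻¹` makes the logarithms small enough that the time at a violating `n`
    -- is at most `M / (M + 1) < 1` times `n ^ (3 - ε / 2)`, which contradicts the lower bound at
    -- this same `n`.
    filter_upwards [hc p κ _ hp, eventually_gt_atTop 0,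
      (natLog_add_one_pow_isLittleO D (half_pos hε)).bound
        (show (0 : ℝ) < (M + 1)⁻¹ by positivity)] with n h1 hn h2
    rw [Real.norm_of_nonneg (by positivity), Real.norm_of_nonneg (by positivity)] at h2
    by_contra! hlt
    have hn' : (0 : ℝ) < n := by exact_mod_cast hn
    have h3 := h1.trans (hM' n 1 hn zero_le_one (by rw [one_mul]; exact hlt.le))
    have hpos : 0 < (n : ℝ) ^ (3 - ε) * (n : ℝ) ^ (ε / 2) := by positivity
    rw [split ε n hn, one_mul] at h3
    have h4 : M * ((n : ℝ) ^ (3 - ε) * ((Nat.log 2 n + 1 : ℕ) : ℝ) ^ D) ≤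
        M * ((n : ℝ) ^ (3 - ε) * ((M + 1)⁻¹ * (n : ℝ) ^ (ε / 2))) := by gcongr
    have h5 : M * ((n : ℝ) ^ (3 - ε) * ((M + 1)⁻¹ * (n : ℝ) ^ (ε / 2))) =
        M / (M + 1) * ((n : ℝ) ^ (3 - ε) * (n : ℝ) ^ (ε / 2)) := by
      rw [div_eq_mul_inv]; ring
    have h6 : M / (M + 1) < 1 := by
      rw [div_lt_one (by positivity)]
      linarith
    nlinarith [mul_lt_mul_of_pos_right h6 hpos]
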